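/- Let $b\ge 3$, $k\ge 2$ and $n\ge 0$ be integers with $k\mid n$, and let $d_1,d_2\in\{0,1,\dots,b-1\}$ be distinct and coprime. Let $\mu_n:\mathbf Z\to\mathbf R$ be the function with $\mu_n(m)=2^{-n}$ if $m=\big(\sum_{0\le i<n}x_ib^i\big)^k$ for some $x_0,\dots,x_{n-1}\in\{d_1,d_2\}$, and $\mu_n(m)=0$ otherwise, and put $\widehat{\mu_n}(\theta)=\sum_{m\in\mathbf Z}\mu_n(m)e^{2\pi i m\theta}$ for $\theta\in\mathbf R$. For $\alpha\in\mathbf R$ write $\Vert\alpha\Vert$ for the distance from $\alpha$ to the nearest integer and $\tilde{\mathrm w}_n(\alpha)=\sum_{0\le i<n}\Vert\alpha b^i\Vert^2$. Set $N:=b^n$ and $C:=b^{7k^2/2}$. Let $\delta\in(0,1]$ and $\theta\in\mathbf R$, and suppose that $|\widehat{\mu_n}(\theta)|\ge\delta$ and $N\ge(2/\delta)^C$. Then there are at least $(\delta/2)^CN^{k-1}$ integers $m$ with $|m|\le CN^{k-1}$ and $\tilde{\mathrm w}_n(\theta m)\le C\log(2/\delta)$, where $\log$ is the natural logarithm. 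-/

import Mathlib

namespace RestrictedDigits

noncomputable section

/-- `‖x‖`: the distance from the real number `x` to the nearest integer. -/
def distNearestInt (x : ℝ) : ℝ := |x - round x|

/-- `m` is the `k`-th power of an integer `∑ i < n, x i * b ^ i`, each of whose `n` base `b`
digits `x i` is `d₁` or `d₂`. -/
def IsDigitPower (b k d₁ d₂ n : ℕ) (m : ℤ) : Prop :=
  ∃ x : Fin n → ℕ, (∀ i, x i = d₁ ∨ x i = d₂) ∧
    m = (∑ i : Fin n, (x i : ℤ) * (b : ℤ) ^ (i : ℕ)) ^ k

open Classical in
/-- The function `μ_n` on the integers: `2 ^ (-n)` at each `k`-th power of an integer with `n`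
base `b` digits that all lie in `{d₁, d₂}`, and `0` elsewhere. -/
def mu (b k d₁ d₂ n : ℕ) (m : ℤ) : ℝ :=
  if IsDigitPower b k d₁ d₂ n m then ((2 : ℝ) ^ n)⁻¹ else 0

/-- The function `μ_n` has finite support, so that the series that defines its Fourier transform
is a finite sum. -/
theorem mu_support_finite (b k d₁ d₂ n : ℕ) :
    (Function.support (mu b k d₁ d₂ n)).Finite := by
  have hfin : (Set.pi Set.univ (fun _ : Fin n => ({d₁, d₂} : Set ℕ))).Finite :=
    Set.Finite.pi fun _ => Set.toFinite _
  refine (hfin.image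
    (fun x => (∑ i : Fin n, (x i : ℤ) * (b : ℤ) ^ (i : ℕ)) ^ k)).subset ?_
  intro m hm
  have h : IsDigitPower b k d₁ d₂ n m := by
    by_contra h
    exact hm (by simp [mu, h])
  obtain ⟨x, hx, rfl⟩ := h
  exact ⟨x, fun i _ => by simpa using hx i, rfl⟩

/-- The Fourier transform `∑ m, μ_n(m) e(m θ)`, where `e(t) = exp(2 π i t)`. -/
def muHat (b k d₁ d₂ n : ℕ) (θ : ℝ) : ℂ :=
  ∑' m : ℤ, (mu b k d₁ d₂ n m : ℂ) * Complex.exp (2 * Real.pi * Complex.I * (m * θ))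

/-- The analytic weight `∑ i < n, ‖α b ^ i‖ ^ 2`. -/
def wTilde (b n : ℕ) (α : ℝ) : ℝ :=
  ∑ i ∈ Finset.range n, distNearestInt (α * (b : ℝ) ^ i) ^ 2

end

end RestrictedDigits

namespace RestrictedDigits

open Finset
open scoped BigOperators

/-! ### Distance to the nearest integer -/

/-! Cut the n = qk digits into k blocks by position modulo k. The integer raised to the power k is
then a constant plus k independent terms, each a multiple of a number L(x) with q digits 0 or 1 in
base B = b^k. Applying Cauchy–Schwarz k − 1 times (`norm_expect_expPhase_pow_le`) leaves an average
over one block of a phase linear in its digits. That average is a product of cosines, so if it is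
large then the weight at θκ∏(L(x_j) − L(x'_j)) is small. This holds for a proportion of tuples x
that is polynomial in δ, with x' and the nonzero integer κ fixed (`exists_popular_tuples`).

There are only 2^(q(k−1)) such tuples, far fewer than N^(k−1), where N = B^q. But the square root of
the weight is subadditive, so sums of boundedly many good integers stay good, and `exists_expansion`
shows that these sums are numerous. For one factor, a subset of {0,1}^q of density α has a (B −
1)-fold sumset of density at least α^(B−1) in {0,…,B−1}^q (`card_add_cube_ge`), and these vectors
are base B expansions of distinct integers. For more factors, induct: double counting gives many v,
each with many multipliers a such that av is good. Two popular multipliers a ≠ a' that are close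
together have small gcd, so av + a'v' takes many values (`card_image_lin_comb_ge`). -/

lemma distNearestInt_nonneg (x : ℝ) : 0 ≤ distNearestInt x := abs_nonneg _

lemma distNearestInt_le_abs_sub (x : ℝ) (m : ℤ) : distNearestInt x ≤ |x - m| := round_le x m

lemma distNearestInt_add_le (x y : ℝ) :
    distNearestInt (x + y) ≤ distNearestInt x + distNearestInt y := by
  refine (distNearestInt_le_abs_sub (x + y) (round x + round y)).trans ?_
  push_cast
  rw [show x + y - ((round x : ℝ) + round y) = (x - round x) + (y - round y) by ring]
  exact abs_add_le _ _

lemma distNearestInt_mul_nat_le (x : ℝ) (m : ℕ) :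
    distNearestInt (x * m) ≤ m * distNearestInt x := by
  refine (distNearestInt_le_abs_sub (x * m) (round x * m)).trans_eq ?_
  push_cast
  rw [← sub_mul, abs_mul, Nat.abs_cast, mul_comm, distNearestInt]

/-- Reduce t to its signed distance s from the nearest integer; for |s| ≤ 1/2, cos(πs) ≤ 1 − 2s² ≤
exp(−2s²). -/
lemma abs_cos_pi_mul_le (t : ℝ) :
    |Real.cos (Real.pi * t)| ≤ Real.exp (-(2 * distNearestInt t ^ 2)) := by
  set s := t - round t with hs
  have habs : |s| ≤ 1 / 2 := abs_sub_round t
  have hcos : |Real.cos (Real.pi * t)| = |Real.cos (Real.pi * s)| := by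
    have : Real.pi * s = Real.pi * t - (round t : ℤ) * Real.pi := by rw [hs]; ring
    rw [this, Real.cos_sub_int_mul_pi, abs_mul, abs_zpow]
    simp
  have hpi := Real.pi_pos
  have hle : |Real.pi * s| ≤ Real.pi / 2 := by
    rw [abs_mul, abs_of_pos hpi]; nlinarith
  have h0 : 0 ≤ Real.cos (Real.pi * s) := Real.cos_nonneg_of_mem_Icc (abs_le.1 hle)
  rw [hcos, abs_of_nonneg h0]
  have h1 := Real.cos_le_one_sub_mul_cos_sq (x := Real.pi * s) (by linarith)
  have h2 : 2 / Real.pi ^ 2 * (Real.pi * s) ^ 2 = 2 * distNearestInt t ^ 2 := by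
    rw [distNearestInt, sq_abs, ← hs]; field_simp
  rw [h2] at h1
  linarith [Real.add_one_le_exp (-(2 * distNearestInt t ^ 2))]

/-! ### The analytic weight -/

/-- Minkowski's inequality in ℓ². Besides vanishing at 0, this is all that the additive expansion
needs from the weight. -/
lemma sqrt_wTilde_add_le (b n : ℕ) (x y : ℝ) :
    √(wTilde b n (x + y)) ≤ √(wTilde b n x) + √(wTilde b n y) := by
  have h := Real.Lp_add_le (range n) (fun i => distNearestInt (x * (b : ℝ) ^ i))
    (fun i => distNearestInt (y * (b : ℝ) ^ i)) (p := 2) (by norm_num)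
  simp only [abs_of_nonneg (distNearestInt_nonneg _),
    abs_of_nonneg (add_nonneg (distNearestInt_nonneg _) (distNearestInt_nonneg _)),
    Real.rpow_two, ← Real.sqrt_eq_rpow] at h
  refine le_trans (Real.sqrt_le_sqrt (Finset.sum_le_sum fun i _ => ?_)) h
  rw [add_mul]
  exact pow_le_pow_left₀ (distNearestInt_nonneg _) (distNearestInt_add_le _ _) 2

/-- Only the digits in positions divisible by `k` matter, up to a constant factor. -/
lemma wTilde_mul_le (b q k : ℕ) (hb : 3 ≤ b) (x : ℝ) :
    wTilde b (q * k) x ≤ (b : ℝ) ^ (2 * k) *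
      ∑ i ∈ range q, distNearestInt (x * ((b ^ k : ℕ) : ℝ) ^ i) ^ 2 := by
  have hsplit : wTilde b (q * k) x =
      ∑ i ∈ range q, ∑ r ∈ range k, distNearestInt (x * (b : ℝ) ^ (r + k * i)) ^ 2 := by
    rw [wTilde, Finset.sum_range, ← finProdFinEquiv.sum_comp, Fintype.sum_prod_type,
      Finset.sum_range]
    refine Finset.sum_congr rfl fun i _ => ?_
    rw [Finset.sum_range]
    rfl
  rw [hsplit, Finset.mul_sum]
  refine Finset.sum_le_sum fun i _ => ?_
  have hb1 : (3 : ℝ) ≤ b := by exact_mod_cast hb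
  -- Since ‖yb^r‖ ≤ b^r‖y‖, moving from position k * i to r + k * i costs a factor b^(2r).
  have hgeom : ∑ r ∈ range k, ((b : ℝ) ^ 2) ^ r ≤ (b : ℝ) ^ (2 * k) := by
    have h := geom_sum_mul ((b : ℝ) ^ 2) k
    have h2 : 0 ≤ ∑ r ∈ range k, ((b : ℝ) ^ 2) ^ r := by positivity
    rw [pow_mul]
    have h3 : (2 : ℝ) ≤ (b : ℝ) ^ 2 := by nlinarith
    nlinarith [mul_nonneg h2 (sub_nonneg.2 h3)]
  calc ∑ r ∈ range k, distNearestInt (x * (b : ℝ) ^ (r + k * i)) ^ 2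
      ≤ ∑ r ∈ range k, ((b : ℝ) ^ 2) ^ r *
          distNearestInt (x * ((b ^ k : ℕ) : ℝ) ^ i) ^ 2 := by
        refine Finset.sum_le_sum fun r _ => ?_
        have h := distNearestInt_mul_nat_le (x * ((b ^ k : ℕ) : ℝ) ^ i) (b ^ r)
        have h3 := pow_le_pow_left₀ (distNearestInt_nonneg _) h 2
        refine le_trans (le_of_eq ?_) (h3.trans_eq ?_)
        · push_cast
          rw [pow_add, pow_mul]; ring_nf
        · push_cast
          ring
    _ ≤ _ := by
        rw [← Finset.sum_mul]
        exact mul_le_mul_of_nonneg_right hgeom (sq_nonneg _)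

/-! ### Exponential sums over cubes -/

/-- `e(t) = exp(2 π i t)`. -/
noncomputable def expPhase (t : ℝ) : ℂ := Complex.exp (2 * Real.pi * Complex.I * t)

lemma expPhase_add (s t : ℝ) : expPhase (s + t) = expPhase s * expPhase t := by
  rw [expPhase, expPhase, expPhase, ← Complex.exp_add]; push_cast; ring_nf

lemma norm_expPhase (t : ℝ) : ‖expPhase t‖ = 1 := by
  rw [expPhase, show (2 * Real.pi * Complex.I * t : ℂ) = ((2 * Real.pi * t : ℝ) : ℂ) * Complex.I by
    push_cast; ring, Complex.norm_exp_ofReal_mul_I]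

lemma conj_expPhase (t : ℝ) : (starRingEnd ℂ) (expPhase t) = expPhase (-t) := by
  rw [expPhase, expPhase, ← Complex.exp_conj]
  simp [map_ofNat (starRingEnd ℂ) 2]

lemma expPhase_sum {ι : Type*} (s : Finset ι) (f : ι → ℝ) :
    expPhase (∑ i ∈ s, f i) = ∏ i ∈ s, expPhase (f i) := by
  simp only [expPhase]
  rw [← Complex.exp_sum, ← Finset.mul_sum]
  push_cast; rfl

lemma norm_one_add_expPhase (t : ℝ) : ‖1 + expPhase t‖ = 2 * |Real.cos (Real.pi * t)| := by
  have : 1 + expPhase t = 2 * Complex.cos ((Real.pi * t : ℝ) : ℂ) * expPhase (t / 2) := by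
    rw [Complex.two_cos, expPhase, expPhase, add_mul, ← Complex.exp_add, ← Complex.exp_add,
      add_comm]
    congr 1
    · congr 1; push_cast; ring
    · rw [← Complex.exp_zero]; congr 1; push_cast; ring
  rw [this, norm_mul, norm_expPhase, norm_mul, ← Complex.ofReal_cos, Complex.norm_real]
  simp

/-- The average factors over the coordinates, and |1 + e(t)| = 2|cos πt|. -/
lemma norm_expect_expPhase_cube {q : ℕ} (c : Fin q → ℝ) :
    ‖𝔼 y : Fin q → Fin 2, expPhase (∑ i, ((y i : ℕ) : ℝ) * c i)‖ =
      ∏ i, |Real.cos (Real.pi * c i)| := by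
  have h : ∑ y : Fin q → Fin 2, expPhase (∑ i, ((y i : ℕ) : ℝ) * c i) =
      ∏ i, (1 + expPhase (c i)) := by
    simp only [expPhase_sum]
    rw [← Fintype.prod_sum (fun i (j : Fin 2) => expPhase (((j : ℕ) : ℝ) * c i))]
    refine Finset.prod_congr rfl fun i _ => ?_
    simp [Fin.sum_univ_two, expPhase]
  rw [Fintype.expect_eq_sum_div_card, h, norm_div, norm_prod]
  simp only [norm_one_add_expPhase, Finset.prod_mul_distrib]
  simp

lemma sum_distNearestInt_sq_le {q : ℕ} (c : Fin q → ℝ) {η : ℝ} (hη : 0 < η)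
    (h : η ≤ ‖𝔼 y : Fin q → Fin 2, expPhase (∑ i, ((y i : ℕ) : ℝ) * c i)‖) :
    2 * ∑ i, distNearestInt (c i) ^ 2 ≤ Real.log (1 / η) := by
  rw [norm_expect_expPhase_cube] at h
  have h1 : η ≤ Real.exp (-(2 * ∑ i, distNearestInt (c i) ^ 2)) := by
    refine h.trans ((Finset.prod_le_prod (fun i _ => abs_nonneg _)
      fun i _ => abs_cos_pi_mul_le (c i)).trans_eq ?_)
    rw [← Real.exp_sum, Finset.sum_neg_distrib, Finset.mul_sum]
  have h2 := (Real.log_le_iff_le_exp hη).2 h1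
  rw [one_div, Real.log_inv]
  linarith

end RestrictedDigits

namespace RestrictedDigits

open Finset
open scoped BigOperators

/-! ### Repeated Cauchy–Schwarz -/

lemma norm_expect_le {ι : Type*} [Fintype ι] (f : ι → ℂ) : ‖𝔼 i, f i‖ ≤ 𝔼 i, ‖f i‖ := by
  rw [Fintype.expect_eq_sum_div_card, Fintype.expect_eq_sum_div_card, norm_div]
  simp only [Complex.norm_natCast]
  gcongr
  exact norm_sum_le _ _

lemma pow_expect_le {ι : Type*} [Fintype ι] [Nonempty ι] (f : ι → ℝ) (hf : ∀ i, 0 ≤ f i) (n : ℕ) :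
    (𝔼 i, f i) ^ n ≤ 𝔼 i, f i ^ n := by
  have hc : (0 : ℝ) < Fintype.card ι := by exact_mod_cast Fintype.card_pos
  have h := Real.pow_arith_mean_le_arith_mean_pow univ (fun _ : ι => (Fintype.card ι : ℝ)⁻¹) f
    (fun _ _ => by positivity) (by simp [hc.ne']) (fun i _ => hf i) n
  simpa only [Fintype.expect_eq_sum_div_card, div_eq_inv_mul, Finset.mul_sum] using h

/-- Cauchy–Schwarz in z; the square is opened into x and a copy x', which both become parameters
outside the norm. -/
lemma sq_norm_expect_expect_le {X Z : Type*} [Fintype X] [Fintype Z] [Nonempty Z]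
    (F : X → Z → ℂ) :
    ‖𝔼 x, 𝔼 z, F x z‖ ^ 2 ≤ 𝔼 x', 𝔼 x, ‖𝔼 z, F x z * (starRingEnd ℂ) (F x' z)‖ := by
  rw [Finset.expect_comm]
  calc ‖𝔼 z, 𝔼 x, F x z‖ ^ 2 ≤ (𝔼 z, ‖𝔼 x, F x z‖) ^ 2 :=
        pow_le_pow_left₀ (norm_nonneg _) (norm_expect_le _) 2
    _ ≤ 𝔼 z, ‖𝔼 x, F x z‖ ^ 2 := pow_expect_le _ (fun _ => norm_nonneg _) 2
    _ = ‖((𝔼 z, ‖𝔼 x, F x z‖ ^ 2 : ℝ) : ℂ)‖ := by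
        rw [Complex.norm_real, Real.norm_of_nonneg (Finset.expect_nonneg fun _ _ => by positivity)]
    _ = ‖𝔼 x', 𝔼 x, 𝔼 z, F x z * (starRingEnd ℂ) (F x' z)‖ := by
        congr 1
        have h (z : Z) : ((‖𝔼 x, F x z‖ ^ 2 : ℝ) : ℂ) =
            𝔼 x', 𝔼 x, F x z * (starRingEnd ℂ) (F x' z) := by
          rw [Complex.ofReal_pow, ← Complex.mul_conj']
          simp only [Fintype.expect_eq_sum_div_card, map_div₀, map_sum, map_natCast]
          rw [← Finset.sum_div, div_mul_div_comm, div_div, Finset.sum_mul_sum, Finset.sum_comm]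
        rw [Fintype.expect_eq_sum_div_card, Complex.ofReal_div, Complex.ofReal_sum,
          Finset.sum_congr rfl fun z _ => h z, Complex.ofReal_natCast,
          ← Fintype.expect_eq_sum_div_card, Finset.expect_comm]
        exact Finset.expect_congr rfl fun x' _ => Finset.expect_comm _ _ _
    _ ≤ 𝔼 x', 𝔼 x, ‖𝔼 z, F x z * (starRingEnd ℂ) (F x' z)‖ :=
        (norm_expect_le _).trans (Finset.expect_le_expect fun x' _ => norm_expect_le _)

lemma expect_fin_succ {H M : Type*} [Fintype H] [AddCommMonoid M] [Module ℚ≥0 M] {K : ℕ}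
    (f : (Fin (K + 1) → H) → M) :
    𝔼 x, f x = 𝔼 h, 𝔼 x : Fin K → H, f (Fin.cons h x) := by
  rw [← Finset.expect_product' univ univ fun h (x : Fin K → H) => f (Fin.cons h x),
    Finset.univ_product_univ]
  exact (Fintype.expect_equiv (Fin.consEquiv fun _ => H) _ _ fun _ => rfl).symm

open Polynomial in
lemma natDegree_taylor_sub_le (P : ℝ[X]) {K : ℕ} (hP : P.natDegree ≤ K + 2) (r s : ℝ) :
    (taylor r P - taylor s P).natDegree ≤ K + 1 := by
  rw [natDegree_le_iff_coeff_eq_zero]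
  intro n hn
  have hz (t : ℝ) : (taylor t P).coeff n = P.coeff n := by
    rw [taylor_coeff, show hasseDeriv n P = C (P.coeff n) from ?_, eval_C]
    ext j
    rw [hasseDeriv_coeff, coeff_C]
    split_ifs with hj
    · simp [hj]
    · rw [coeff_eq_zero_of_natDegree_lt (by omega), mul_zero]
  rw [coeff_sub, hz, hz, sub_self]

open Polynomial in
-- One differencing multiplies the top coefficient by the degree and the shift; iteration produces
-- the factorial and the product of differences.
lemma coeff_taylor_sub (P : ℝ[X]) {K : ℕ} (hP : P.natDegree ≤ K + 2) (r s : ℝ) :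
    (taylor r P - taylor s P).coeff (K + 1) = (K + 2) * P.coeff (K + 2) * (r - s) := by
  have hz (t : ℝ) : (taylor t P).coeff (K + 1) =
      P.coeff (K + 1) + (K + 2) * P.coeff (K + 2) * t := by
    rw [taylor_coeff, show hasseDeriv (K + 1) P =
      C (P.coeff (K + 1)) + C ((K + 2) * P.coeff (K + 2)) * X from ?_]
    · simp
    ext j
    rw [hasseDeriv_coeff, coeff_add, coeff_C, coeff_C_mul, coeff_X]
    rcases j with _ | _ | j
    · simp
    · rw [show 0 + 1 + (K + 1) = (K + 1) + 1 by omega, Nat.choose_succ_self_right]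
      push_cast
      simp only [zero_add, mul_one]
      ring_nf
    · rw [coeff_eq_zero_of_natDegree_lt (by omega)]
      simp
  rw [coeff_sub, hz, hz]; ring

open Polynomial in
-- Weyl differencing, block by block: each Cauchy–Schwarz removes a block and replaces P by a
-- difference of two translates, lowering the degree bound by one. At the end P is linear, and its
-- constant term does not affect the norm.
lemma norm_expect_expPhase_pow_le {H Y : Type*} [Fintype H] [Nonempty H] [Fintype Y] [Nonempty Y]
    (K : ℕ) (P : ℝ[X]) (hP : P.natDegree ≤ K + 1) (L : Fin K → H → ℝ) (l : Y → ℝ) :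
    ‖𝔼 x : Fin K → H, 𝔼 y, expPhase (P.eval (∑ j, L j (x j) + l y))‖ ^ 2 ^ K ≤
      𝔼 x' : Fin K → H, 𝔼 x : Fin K → H,
        ‖𝔼 y, expPhase ((K + 1).factorial * P.coeff (K + 1) *
          (∏ j, (L j (x j) - L j (x' j))) * l y)‖ := by
  induction K generalizing P with
  | zero =>
    have hev (y : Y) : P.eval (l y) = P.coeff 0 + P.coeff 1 * l y := by
      rw [eval_eq_sum_range' (n := 2) (by omega)]
      simp [Finset.sum_range_succ]
    simp [hev, expPhase_add, ← Finset.mul_expect, norm_expPhase]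
  | succ K ih =>
    set Q : H → H → ℝ[X] := fun h h' => taylor (L 0 h) P - taylor (L 0 h') P with hQ
    have hkey (h h' : H) (s : ℝ) : expPhase (P.eval (L 0 h + s)) *
        (starRingEnd ℂ) (expPhase (P.eval (L 0 h' + s))) = expPhase ((Q h h').eval s) := by
      rw [conj_expPhase, ← expPhase_add, hQ]
      simp [taylor_eval, add_comm, sub_eq_add_neg]
    calc _ = (‖𝔼 h, 𝔼 z : (Fin K → H) × Y, expPhase (P.eval (L 0 h +
          (∑ j : Fin K, L j.succ (z.1 j) + l z.2)))‖ ^ 2) ^ 2 ^ K := by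
          rw [← pow_mul, ← pow_succ', expect_fin_succ]
          congr 2
          refine Finset.expect_congr rfl fun h _ => ?_
          rw [← Finset.univ_product_univ, Finset.expect_product]
          simp [Fin.sum_univ_succ, add_assoc]
      _ ≤ (𝔼 h', 𝔼 h, ‖𝔼 z : (Fin K → H) × Y, expPhase ((Q h h').eval
            (∑ j : Fin K, L j.succ (z.1 j) + l z.2))‖) ^ 2 ^ K := by
          refine pow_le_pow_left₀ (by positivity) ?_ _
          refine (sq_norm_expect_expect_le _).trans_eq ?_
          simp only [hkey]
      _ ≤ 𝔼 h', 𝔼 h, ‖𝔼 z : (Fin K → H) × Y, expPhase ((Q h h').eval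
            (∑ j : Fin K, L j.succ (z.1 j) + l z.2))‖ ^ 2 ^ K := by
          refine (pow_expect_le _ (fun h' => Finset.expect_nonneg fun _ _ => norm_nonneg _)
            _).trans (Finset.expect_le_expect fun h' _ => ?_)
          exact pow_expect_le _ (fun _ => norm_nonneg _) _
      _ ≤ 𝔼 h', 𝔼 h, 𝔼 x' : Fin K → H, 𝔼 x : Fin K → H,
          ‖𝔼 y, expPhase ((K + 1).factorial * (Q h h').coeff (K + 1) *
          (∏ j : Fin K, (L j.succ (x j) - L j.succ (x' j))) * l y)‖ := by
          refine Finset.expect_le_expect fun h' _ => Finset.expect_le_expect fun h _ => ?_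
          rw [← Finset.univ_product_univ, Finset.expect_product]
          exact ih (Q h h') (natDegree_taylor_sub_le P hP _ _) fun j => L j.succ
      _ = _ := by
          rw [expect_fin_succ]
          refine Finset.expect_congr rfl fun h' _ => ?_
          rw [Finset.expect_comm]
          refine Finset.expect_congr rfl fun x' _ => ?_
          rw [expect_fin_succ]
          refine Finset.expect_congr rfl fun h _ => Finset.expect_congr rfl fun x _ => ?_
          congr 1
          refine Finset.expect_congr rfl fun y _ => ?_
          congr 1
          rw [coeff_taylor_sub P hP, Fin.prod_univ_succ, Nat.factorial_succ (K + 1)]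
          push_cast
          simp only [Fin.cons_zero, Fin.cons_succ]
          ring

end RestrictedDigits

namespace RestrictedDigits

open Finset
open scoped BigOperators Pointwise

/-! ### Sums of subsets of a cube -/

/-- The weight of `M n` is split as u n + v n, a partial sum and a tail of a^j b^(p−j), between the
bounds `h₂` and `h₁`. The resulting coefficient b u(n+1) + a v(n) of `β n` does not depend on n. -/
lemma geom_mul_sum_le (p : ℕ) {a b : ℝ} (ha : 0 ≤ a) (hb : 0 ≤ b) (β M : ℕ → ℝ)
    (h₁ : ∀ n ≤ p, a * β n ≤ M n) (h₂ : ∀ n ≤ p, b * β n ≤ M (n + 1)) :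
    (∑ j ∈ range (p + 2), a ^ j * b ^ (p + 1 - j)) * ∑ n ∈ range (p + 1), β n ≤
      (∑ j ∈ range (p + 1), a ^ j * b ^ (p - j)) * ∑ n ∈ range (p + 2), M n := by
  set g : ℕ → ℝ := fun j => a ^ j * b ^ (p - j) with hg
  have hg0 (j : ℕ) : 0 ≤ g j := by positivity
  set u : ℕ → ℝ := fun n => ∑ j ∈ range n, g j with hu
  set v : ℕ → ℝ := fun n => ∑ j ∈ Ico n (p + 1), g j with hv
  have huv (n : ℕ) (hn : n ≤ p + 1) : u n + v n = ∑ j ∈ range (p + 1), g j :=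
    Finset.sum_range_add_sum_Ico g hn
  have hcomb (n : ℕ) (hn : n ≤ p) :
      b * u (n + 1) + a * v n = ∑ j ∈ range (p + 2), a ^ j * b ^ (p + 1 - j) := by
    rw [← Finset.sum_range_add_sum_Ico _ (show n + 1 ≤ p + 2 by omega), hu, hv, Finset.mul_sum,
      Finset.mul_sum, ← Finset.sum_Ico_add' _ n (p + 1) 1]
    congr 1
    · refine Finset.sum_congr rfl fun j hj => ?_
      rw [Finset.mem_range] at hj
      rw [hg, show p + 1 - j = (p - j) + 1 by omega, pow_succ]; ring
    · refine Finset.sum_congr rfl fun j hj => ?_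
      rw [hg, show p + 1 - (j + 1) = p - j by omega, pow_succ]; ring
  have hM : (∑ j ∈ range (p + 1), g j) * ∑ n ∈ range (p + 2), M n =
      ∑ n ∈ range (p + 1), (u (n + 1) * M (n + 1) + v n * M n) := by
    have hu0 : u 0 = 0 := by simp [hu]
    have hv0 : v (p + 1) = 0 := by simp [hv]
    rw [Finset.mul_sum, Finset.sum_add_distrib]
    have e1 := Finset.sum_range_succ' (fun n => u n * M n) (p + 1)
    have e2 := Finset.sum_range_succ (fun n => v n * M n) (p + 1)
    rw [hu0, zero_mul, add_zero] at e1
    rw [hv0, zero_mul, add_zero] at e2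
    rw [← e1, ← e2, ← Finset.sum_add_distrib]
    refine Finset.sum_congr rfl fun n hn => ?_
    rw [Finset.mem_range] at hn
    rw [← huv n (by omega), add_mul]
  rw [hM, Finset.mul_sum]
  refine Finset.sum_le_sum fun n hn => ?_
  rw [Finset.mem_range] at hn
  rw [← hcomb n (by omega)]
  have hu1 : 0 ≤ u (n + 1) := Finset.sum_nonneg fun j _ => hg0 j
  have hv1 : 0 ≤ v n := Finset.sum_nonneg fun j _ => hg0 j
  nlinarith [mul_le_mul_of_nonneg_left (h₁ n (by omega)) hv1,
    mul_le_mul_of_nonneg_left (h₂ n (by omega)) hu1]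

lemma pow_mul_pow_add_le (m j : ℕ) (hj : j ≤ m) {a b : ℝ} (ha : 0 ≤ a) (hb : 0 ≤ b) :
    a ^ j * b ^ (m - j) + a ^ (m - j) * b ^ j ≤ a ^ m + b ^ m := by
  have e : m = j + (m - j) := by omega
  have h : 0 ≤ (a ^ j - b ^ j) * (a ^ (m - j) - b ^ (m - j)) := by
    rcases le_total a b with h | h
    · exact mul_nonneg_of_nonpos_of_nonpos (sub_nonpos.2 (pow_le_pow_left₀ ha h _))
        (sub_nonpos.2 (pow_le_pow_left₀ ha h _))
    · exact mul_nonneg (sub_nonneg.2 (pow_le_pow_left₀ hb h _))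
        (sub_nonneg.2 (pow_le_pow_left₀ hb h _))
  have ea : a ^ m = a ^ j * a ^ (m - j) := by rw [← pow_add, ← e]
  have eb : b ^ m = b ^ j * b ^ (m - j) := by rw [← pow_add, ← e]
  rw [ea, eb]
  nlinarith

/-- With h the longer sum and s = a^(p+1) + b^(p+1), the left side is (p+2)(2h − s). The claim
becomes 2h ≤ (p+2)s, proved by pairing j with p+1−j. -/
lemma mul_geom_le_mul_geom (p : ℕ) {a b : ℝ} (ha : 0 ≤ a) (hb : 0 ≤ b) :
    (p + 2) * (a + b) * ∑ j ∈ range (p + 1), a ^ j * b ^ (p - j) ≤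
      2 * (p + 1) * ∑ j ∈ range (p + 2), a ^ j * b ^ (p + 1 - j) := by
  set h := ∑ j ∈ range (p + 2), a ^ j * b ^ (p + 1 - j) with hh
  have e : (a + b) * ∑ j ∈ range (p + 1), a ^ j * b ^ (p - j) =
      2 * h - (a ^ (p + 1) + b ^ (p + 1)) := by
    have e1 : a * ∑ j ∈ range (p + 1), a ^ j * b ^ (p - j) = h - b ^ (p + 1) := by
      rw [hh, Finset.mul_sum, Finset.sum_range_succ' _ (p + 1)]
      simp only [pow_zero, one_mul, Nat.sub_zero, add_sub_cancel_right]
      refine Finset.sum_congr rfl fun j _ => ?_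
      rw [show p + 1 - (j + 1) = p - j by omega, pow_succ]; ring
    have e2 : b * ∑ j ∈ range (p + 1), a ^ j * b ^ (p - j) = h - a ^ (p + 1) := by
      rw [hh, Finset.mul_sum, Finset.sum_range_succ _ (p + 1)]
      simp only [Nat.sub_self, pow_zero, mul_one, add_sub_cancel_right]
      refine Finset.sum_congr rfl fun j hj => ?_
      rw [Finset.mem_range] at hj
      rw [show p + 1 - j = (p - j) + 1 by omega, pow_succ]; ring
    rw [add_mul, e1, e2]; ring
  have hsum : 2 * h ≤ (p + 2) * (a ^ (p + 1) + b ^ (p + 1)) := by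
    have hrefl : h = ∑ j ∈ range (p + 2), a ^ (p + 1 - j) * b ^ j := by
      rw [hh, ← Finset.sum_range_reflect]
      refine Finset.sum_congr rfl fun j hj => ?_
      rw [Finset.mem_range] at hj
      rw [show p + 2 - 1 - j = p + 1 - j by omega, show p + 1 - (p + 1 - j) = j by omega]
    have : 2 * h = ∑ j ∈ range (p + 2),
        (a ^ j * b ^ (p + 1 - j) + a ^ (p + 1 - j) * b ^ j) := by
      rw [Finset.sum_add_distrib, ← hrefl, ← hh]; ring
    rw [this]
    refine (Finset.sum_le_card_nsmul _ _ (a ^ (p + 1) + b ^ (p + 1)) fun j hj => ?_).trans_eq ?_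
    · rw [Finset.mem_range] at hj
      exact pow_mul_pow_add_le (p + 1) j (by omega) ha hb
    · rw [Finset.card_range, nsmul_eq_mul]
      push_cast
      ring
  rw [mul_assoc, e]
  nlinarith

/-- The one-coordinate case of the sumset bound: `β` and `M` stand for slice sizes of D and D + A,
and a, b for those of A. -/
lemma mul_add_mul_sum_le (p : ℕ) {a b : ℝ} (ha : 0 ≤ a) (hb : 0 ≤ b) (β M : ℕ → ℝ)
    (hβ : ∀ n, 0 ≤ β n) (hM : ∀ n, 0 ≤ M n)
    (h₁ : ∀ n ≤ p, a * β n ≤ M n) (h₂ : ∀ n ≤ p, b * β n ≤ M (n + 1)) :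
    (p + 2) * (a + b) * ∑ n ∈ range (p + 1), β n ≤
      2 * (p + 1) * ∑ n ∈ range (p + 2), M n := by
  have hβs : 0 ≤ ∑ n ∈ range (p + 1), β n := Finset.sum_nonneg fun n _ => hβ n
  have hMs : 0 ≤ ∑ n ∈ range (p + 2), M n := Finset.sum_nonneg fun n _ => hM n
  set G := ∑ j ∈ range (p + 1), a ^ j * b ^ (p - j) with hG
  have h3 := geom_mul_sum_le p ha hb β M h₁ h₂
  have h4 := mul_geom_le_mul_geom p ha hb
  rcases eq_or_lt_of_le (add_nonneg ha hb) with h | h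
  · rw [← h]; simp; positivity
  have hG0 : 0 < G := by
    rcases eq_or_lt_of_le ha with h0 | h0
    · have hb0 : 0 < b := by linarith
      refine Finset.sum_pos' (fun j _ => by positivity) ⟨0, by simp, by simpa using pow_pos hb0 p⟩
    · refine Finset.sum_pos' (fun j _ => by positivity) ⟨p, by simp, by simpa using pow_pos h0 p⟩
  refine le_of_mul_le_mul_left ?_ hG0
  calc G * ((p + 2) * (a + b) * ∑ n ∈ range (p + 1), β n)
      = ((p + 2) * (a + b) * G) * ∑ n ∈ range (p + 1), β n := by ring
    _ ≤ (2 * (p + 1) * ∑ j ∈ range (p + 2), a ^ j * b ^ (p + 1 - j)) *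
        ∑ n ∈ range (p + 1), β n := mul_le_mul_of_nonneg_right h4 hβs
    _ = 2 * (p + 1) * ((∑ j ∈ range (p + 2), a ^ j * b ^ (p + 1 - j)) *
        ∑ n ∈ range (p + 1), β n) := by ring
    _ ≤ 2 * (p + 1) * (G * ∑ n ∈ range (p + 2), M n) :=
        mul_le_mul_of_nonneg_left h3 (by positivity)
    _ = _ := by ring

/-- The slice of a set of vectors at a given first coordinate. -/
def slice {q : ℕ} (D : Finset (Fin (q + 1) → ℕ)) (n : ℕ) : Finset (Fin q → ℕ) :=
  (D.filter fun x => x 0 = n).image Fin.tail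

lemma mem_slice {q : ℕ} {D : Finset (Fin (q + 1) → ℕ)} {n : ℕ} {x : Fin q → ℕ} :
    x ∈ slice D n ↔ (Fin.cons n x : Fin (q + 1) → ℕ) ∈ D := by
  simp only [slice, Finset.mem_image, Finset.mem_filter]
  constructor
  · rintro ⟨y, ⟨hy, rfl⟩, rfl⟩
    rwa [Fin.cons_self_tail]
  · intro h
    exact ⟨_, ⟨h, by simp⟩, by simp⟩

lemma card_eq_sum_card_slice {q m : ℕ} (D : Finset (Fin (q + 1) → ℕ)) (hD : ∀ x ∈ D, x 0 < m) :
    #D = ∑ n ∈ range m, #(slice D n) := by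
  rw [Finset.card_eq_sum_card_fiberwise (f := fun x => x 0) (t := range m)
    (fun x hx => by simpa using hD x hx)]
  refine Finset.sum_congr rfl fun n _ => ?_
  rw [slice, Finset.card_image_of_injOn]
  intro x hx y hy hxy
  simp only [Finset.coe_filter, Set.mem_ofPred_eq] at hx hy
  rw [← Fin.cons_self_tail x, ← Fin.cons_self_tail y, hx.2, hy.2, hxy]

/-- In terms of densities in the respective boxes, D + A is at least as dense as the product of the
densities of D and A. Induct on q: slice n of D plus slice c of A lies in slice n + c of D + A. -/
lemma card_add_cube_ge (q p : ℕ) (D A : Finset (Fin q → ℕ)) (hD : ∀ x ∈ D, ∀ i, x i < p + 1)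
    (hA : ∀ x ∈ A, ∀ i, x i < 2) :
    ((p + 2) ^ q * (#D * #A) : ℝ) ≤ (p + 1) ^ q * 2 ^ q * #(D + A) := by
  induction q with
  | zero =>
    rcases D.eq_empty_or_nonempty with rfl | hDn
    · simp
    rcases A.eq_empty_or_nonempty with rfl | hAn
    · simp
    have h1 : (#D : ℝ) ≤ 1 := by exact_mod_cast Finset.card_le_one_of_subsingleton D
    have h2 : (#A : ℝ) ≤ 1 := by exact_mod_cast Finset.card_le_one_of_subsingleton A
    have h3 : (1 : ℝ) ≤ #(D + A) := by
      exact_mod_cast Finset.card_pos.2 (hDn.add hAn)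
    simp only [pow_zero, one_mul]
    nlinarith [Nat.cast_nonneg (α := ℝ) #D, Nat.cast_nonneg (α := ℝ) #A]
  | succ q ih =>
    have hsub (c n : ℕ) : slice D n + slice A c ⊆ slice (D + A) (n + c) := by
      intro z hz
      obtain ⟨x, hx, y, hy, rfl⟩ := Finset.mem_add.1 hz
      rw [mem_slice] at *
      refine Finset.mem_add.2 ⟨_, hx, _, hy, ?_⟩
      funext i
      refine Fin.cases ?_ (fun i => ?_) i <;> simp
    have hslice (c n : ℕ) : ((p + 2) ^ q * (#(slice D n) * #(slice A c)) : ℝ) ≤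
        (p + 1) ^ q * 2 ^ q * #(slice (D + A) (n + c)) := by
      refine (ih _ _ ?_ ?_).trans ?_
      · intro x hx i
        simpa using hD _ (mem_slice.1 hx) i.succ
      · intro x hx i
        simpa using hA _ (mem_slice.1 hx) i.succ
      · gcongr
        exact hsub c n
    have hcD : (#D : ℝ) = ∑ n ∈ range (p + 1), (#(slice D n) : ℝ) := by
      exact_mod_cast card_eq_sum_card_slice D fun x hx => hD x hx 0
    have hcA : (#A : ℝ) = #(slice A 0) + #(slice A 1) := by
      rw [card_eq_sum_card_slice A fun x hx => hA x hx 0]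
      simp [Finset.sum_range_succ]
    have hcS : (#(D + A) : ℝ) = ∑ n ∈ range (p + 2), (#(slice (D + A) n) : ℝ) := by
      have : ∀ x ∈ D + A, x 0 < p + 2 := by
        intro z hz
        obtain ⟨x, hx, y, hy, rfl⟩ := Finset.mem_add.1 hz
        have h1 := hD x hx 0
        have h2 := hA y hy 0
        simp only [Pi.add_apply]
        omega
      exact_mod_cast card_eq_sum_card_slice (D + A) this
    have h := mul_add_mul_sum_le p (a := #(slice A 0)) (b := #(slice A 1)) (by positivity)
      (by positivity) (fun n => (p + 2) ^ q * (#(slice D n) : ℝ))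
      (fun n => (p + 1) ^ q * 2 ^ q * (#(slice (D + A) n) : ℝ))
      (fun n => by positivity) (fun n => by positivity)
      (fun n _ => by have := hslice 0 n; simp only [add_zero] at this; linarith)
      (fun n _ => by have := hslice 1 n; linarith)
    rw [hcD, hcA, hcS]
    simp only [← Finset.mul_sum] at h
    rw [pow_succ, pow_succ, pow_succ]
    linarith

end RestrictedDigits

namespace RestrictedDigits

open Finset
open scoped BigOperators Pointwise

/-! ### Values of digit strings -/

/-- The integer with base `B` digits `d`. -/
def digitValue (B : ℕ) {q : ℕ} (d : Fin q → ℕ) : ℤ := ∑ i, (d i : ℤ) * (B : ℤ) ^ (i : ℕ)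

lemma digitValue_succ (B : ℕ) {q : ℕ} (d : Fin (q + 1) → ℕ) :
    digitValue B d = d 0 + B * digitValue B (Fin.tail d) := by
  simp only [digitValue, Fin.sum_univ_succ, Fin.tail, Finset.mul_sum, Fin.val_zero, pow_zero,
    mul_one, Fin.val_succ, pow_succ]
  congr 1
  exact Finset.sum_congr rfl fun i _ => by ring

lemma digitValue_nonneg (B : ℕ) {q : ℕ} (d : Fin q → ℕ) : 0 ≤ digitValue B d :=
  Finset.sum_nonneg fun _ _ => by positivity

lemma digitValue_lt {B q : ℕ} (d : Fin q → ℕ) (hd : ∀ i, d i < B) : digitValue B d < B ^ q := by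
  induction q with
  | zero => simp [digitValue]
  | succ q ih =>
    rw [digitValue_succ, pow_succ]
    have h1 := ih (Fin.tail d) fun i => hd i.succ
    have h2 : (d 0 : ℤ) < B := by exact_mod_cast hd 0
    nlinarith

lemma digitValue_injective {B q : ℕ} (d d' : Fin q → ℕ) (hd : ∀ i, d i < B) (hd' : ∀ i, d' i < B)
    (h : digitValue B d = digitValue B d') : d = d' := by
  induction q with
  | zero => exact Subsingleton.elim _ _
  | succ q ih =>
    rw [digitValue_succ, digitValue_succ] at h
    have hlt : (d 0 : ℤ) < B := by exact_mod_cast hd 0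
    have hlt' : (d' 0 : ℤ) < B := by exact_mod_cast hd' 0
    have h0 : (d 0 : ℤ) = d' 0 := by
      have := congrArg (· % (B : ℤ)) h
      simpa [Int.add_mul_emod_self_left, Int.emod_eq_of_lt, hlt, hlt'] using this
    have hB : (B : ℤ) ≠ 0 := by have := hd 0; omega
    have ht : digitValue B (Fin.tail d) = digitValue B (Fin.tail d') := by
      rw [h0] at h
      exact mul_left_cancel₀ hB (add_left_cancel h)
    rw [← Fin.cons_self_tail d, ← Fin.cons_self_tail d',
      ih (Fin.tail d) (Fin.tail d') (fun i => hd i.succ) (fun i => hd' i.succ) ht]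
    congr 1
    exact_mod_cast h0

lemma digitValue_add (B : ℕ) {q : ℕ} (d d' : Fin q → ℕ) :
    digitValue B (d + d') = digitValue B d + digitValue B d' := by
  simp [digitValue, Finset.sum_add_distrib, add_mul]

lemma digitValue_mul (B c : ℕ) {q : ℕ} (d : Fin q → ℕ) :
    digitValue B (fun i => c * d i) = c * digitValue B d := by
  simp [digitValue, Finset.mul_sum, mul_assoc]

/-- The integer with base `B` digits `y i ∈ {0, 1}`. -/
def bitValue (B : ℕ) {q : ℕ} (y : Fin q → Fin 2) : ℤ := digitValue B fun i => (y i : ℕ)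

/-- D is the t-fold sumset of A: its density is at least the t-th power of that of A, and each
summand costs at most R. -/
lemma exists_sum_digits {B q : ℕ} (A : Finset (Fin q → ℕ)) (hA : ∀ x ∈ A, ∀ i, x i < 2)
    (w : ℤ → ℝ) (hw0 : w 0 ≤ 0) (hw : ∀ x y, w (x + y) ≤ w x + w y) (u : ℤ) (R : ℝ)
    (hR : ∀ x ∈ A, w (digitValue B x - u) ≤ R) (t : ℕ) :
    ∃ D : Finset (Fin q → ℕ), (∀ d ∈ D, ∀ i, d i < t + 1) ∧
      ((t + 1) ^ q * (#A : ℝ) ^ t ≤ (2 ^ q) ^ t * #D) ∧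
      ∀ d ∈ D, w (digitValue B d - t * u) ≤ t * R := by
  induction t with
  | zero =>
    refine ⟨{0}, by simp, by simp, ?_⟩
    simpa [digitValue] using hw0
  | succ t ih =>
    obtain ⟨D, h1, h2, h3⟩ := ih
    refine ⟨D + A, ?_, ?_, ?_⟩
    · intro z hz i
      obtain ⟨x, hx, y, hy, rfl⟩ := Finset.mem_add.1 hz
      have := h1 x hx i
      have := hA y hy i
      simp only [Pi.add_apply]
      omega
    · have h := card_add_cube_ge q t D A h1 hA
      refine le_of_mul_le_mul_left ?_ (show (0 : ℝ) < (t + 1) ^ q by positivity)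
      calc ((t : ℝ) + 1) ^ q * ((((t + 1 : ℕ) : ℝ) + 1) ^ q * (#A : ℝ) ^ (t + 1))
          = ((t + 1) ^ q * (#A : ℝ) ^ t) * ((t + 2) ^ q * #A) := by
            push_cast; rw [pow_succ, add_assoc]; norm_num; ring
        _ ≤ ((2 ^ q) ^ t * #D) * ((t + 2) ^ q * #A) := by gcongr
        _ = (2 ^ q) ^ t * ((t + 2) ^ q * (#D * #A)) := by ring
        _ ≤ (2 ^ q) ^ t * ((t + 1) ^ q * 2 ^ q * #(D + A)) := by gcongr
        _ = _ := by rw [pow_succ]; ring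
    · intro z hz
      obtain ⟨x, hx, y, hy, rfl⟩ := Finset.mem_add.1 hz
      rw [digitValue_add]
      have e : digitValue B x + digitValue B y - ((t + 1 : ℕ) : ℤ) * u =
          (digitValue B x - t * u) + (digitValue B y - u) := by push_cast; ring
      rw [e]
      refine (hw _ _).trans ((add_le_add (h3 x hx) (hR y hy)).trans_eq ?_)
      push_cast; ring

/-- Take t = B − 1 summands, the most that can be added without carries; distinct digit vectors then
have distinct values. -/
lemma exists_many_sums {B q : ℕ} (hB : 2 ≤ B) (A : Finset (Fin q → Fin 2)) {α : ℝ} (hα : 0 ≤ α)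
    (hA : α * 2 ^ q ≤ #A) (w : ℤ → ℝ) (hw0 : w 0 ≤ 0) (hw : ∀ x y, w (x + y) ≤ w x + w y)
    (y' : Fin q → Fin 2) {R : ℝ} (hR0 : 0 ≤ R)
    (hR : ∀ y ∈ A, w (bitValue B y - bitValue B y') ≤ R) :
    ∃ V : Finset ℤ, α ^ (B - 1) * (B : ℝ) ^ q ≤ #V ∧
      ∀ m ∈ V, |m| ≤ (B : ℤ) ^ q ∧ w m ≤ B * R := by
  obtain ⟨t, rfl⟩ : ∃ t, B = t + 1 := ⟨B - 1, by omega⟩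
  have hinj : Function.Injective fun (y : Fin q → Fin 2) (i : Fin q) => (y i : ℕ) := by
    intro y z h
    funext i
    exact Fin.ext (congrFun h i)
  obtain ⟨D, h1, h2, h3⟩ := exists_sum_digits (B := t + 1)
    (A.image fun (y : Fin q → Fin 2) (i : Fin q) => (y i : ℕ))
    (by simp only [Finset.mem_image]; rintro _ ⟨y, _, rfl⟩ i; exact (y i).2)
    w hw0 hw (bitValue (t + 1) y') R
    (by simp only [Finset.mem_image]; rintro _ ⟨y, hy, rfl⟩; exact hR y hy) t
  rw [Finset.card_image_of_injective _ hinj] at h2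
  refine ⟨D.image fun d => digitValue (t + 1) d - t * bitValue (t + 1) y', ?_, ?_⟩
  · rw [Finset.card_image_of_injOn]
    · refine le_of_mul_le_mul_left ?_ (show (0 : ℝ) < (2 ^ q) ^ t by positivity)
      refine le_trans ?_ h2
      calc ((2 : ℝ) ^ q) ^ t * (α ^ (t + 1 - 1) * ((t + 1 : ℕ) : ℝ) ^ q)
          = (t + 1) ^ q * (α * 2 ^ q) ^ t := by
            rw [Nat.add_sub_cancel, mul_pow]; push_cast; ring
        _ ≤ _ := by gcongr
    · intro d hd d' hd' h
      exact digitValue_injective d d' (h1 d hd) (h1 d' hd') (sub_left_injective h)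
  · simp only [Finset.mem_image]
    rintro _ ⟨d, hd, rfl⟩
    constructor
    · have a1 := digitValue_nonneg (t + 1) d
      have a2 := digitValue_lt d (h1 d hd)
      have a3 : 0 ≤ (t : ℤ) * bitValue (t + 1) y' :=
        mul_nonneg (by positivity) (digitValue_nonneg _ _)
      have a4 : (t : ℤ) * bitValue (t + 1) y' < ((t + 1 : ℕ) : ℤ) ^ q := by
        rw [bitValue, ← digitValue_mul]
        refine digitValue_lt _ fun i => ?_
        have := (y' i).2
        nlinarith
      rw [abs_le]
      constructor <;> linarith
    · refine (h3 d hd).trans ?_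
      push_cast
      nlinarith

/-! ### Combinatorial lemmas -/

/-- Double counting of the pairs z ∈ f x: unpopular z account for at most E/2 pairs, and each
popular z for at most #X. -/
lemma card_popular_ge {α β : Type*} [DecidableEq β] (X : Finset α) (Z : Finset β)
    (f : α → Finset β) (hf : ∀ x ∈ X, f x ⊆ Z) {E τ : ℝ} (hτ : 0 ≤ τ)
    (hE : E ≤ ∑ x ∈ X, (#(f x) : ℝ)) (hZ : #Z * τ ≤ E / 2) :
    E / 2 ≤ #X * #(Z.filter fun z => τ ≤ #(X.filter fun x => z ∈ f x)) := by
  have hdc : ∑ x ∈ X, (#(f x) : ℝ) = ∑ z ∈ Z, (#(X.filter fun x => z ∈ f x) : ℝ) := by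
    have h := Finset.sum_card_bipartiteAbove_eq_sum_card_bipartiteBelow (s := X) (t := Z)
      (fun x z => z ∈ f x)
    simp only [Finset.bipartiteAbove, Finset.bipartiteBelow] at h
    rw [← Nat.cast_sum, ← Nat.cast_sum, ← h]
    congr 1
    refine Finset.sum_congr rfl fun x hx => ?_
    rw [Finset.filter_mem_eq_inter, Finset.inter_eq_right.2 (hf x hx)]
  rw [hdc, ← Finset.sum_filter_add_sum_filter_not Z
    (fun z => τ ≤ (#(X.filter fun x => z ∈ f x) : ℝ))] at hE
  have h1 : ∑ z ∈ Z with τ ≤ (#(X.filter fun x => z ∈ f x) : ℝ),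
      (#(X.filter fun x => z ∈ f x) : ℝ) ≤
      #(Z.filter fun z => τ ≤ #(X.filter fun x => z ∈ f x)) * (#X : ℝ) := by
    rw [← nsmul_eq_mul]
    refine Finset.sum_le_card_nsmul _ _ _ fun z _ => ?_
    exact_mod_cast Finset.card_filter_le _ _
  have h2 : ∑ z ∈ Z with ¬ τ ≤ (#(X.filter fun x => z ∈ f x) : ℝ),
      (#(X.filter fun x => z ∈ f x) : ℝ) ≤ #Z * τ := by
    refine (Finset.sum_le_card_nsmul _ _ τ fun z hz => ?_).trans ?_
    · exact (not_le.1 (Finset.mem_filter.1 hz).2).le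
    · rw [nsmul_eq_mul]
      gcongr
      exact Finset.filter_subset _ _
  linarith

/-- At least gN/2 elements exceed gN/8 in absolute value, more than the number of intervals of
length about 8/g covering [−N, N]; two share an interval. -/
lemma exists_close_pair (G : Finset ℤ) (N : ℕ) {g : ℝ} (hg : 0 < g) (hg1 : g ≤ 1)
    (hgN : 16 ≤ g * N) (hG : ∀ a ∈ G, |a| ≤ (N : ℤ)) (hcard : g * N ≤ #G) :
    ∃ a ∈ G, ∃ a' ∈ G, a ≠ a' ∧ |((a - a' : ℤ) : ℝ)| ≤ 9 / g ∧ g * N / 8 < |(a : ℝ)| := by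
  set T : ℕ := ⌊g * N / 8⌋₊ with hT
  set l : ℕ := ⌈8 / g⌉₊ with hl
  have hTle : (T : ℝ) ≤ g * N / 8 := Nat.floor_le (by positivity)
  have hl1 : 8 / g ≤ l := Nat.le_ceil _
  have hl2 : (l : ℝ) ≤ 9 / g := by
    have := Nat.ceil_lt_add_one (show 0 ≤ 8 / g by positivity)
    have h1 : 1 ≤ 1 / g := by rw [le_div_iff₀ hg]; linarith
    have h2 : 9 / g = 8 / g + 1 / g := by ring
    rw [h2]
    linarith
  have hl0 : (0 : ℝ) < l := lt_of_lt_of_le (by positivity) hl1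
  have hlz : (0 : ℤ) < l := by exact_mod_cast hl0
  set G' := G \ Finset.Icc (-(T : ℤ)) T with hG'
  have hG'card : g * N / 2 ≤ #G' := by
    have h1 : #G ≤ #G' + #(Finset.Icc (-(T : ℤ)) T) := by
      rw [hG']; exact Finset.card_le_card_sdiff_add_card
    rw [Int.card_Icc] at h1
    have h2 : (#G : ℝ) ≤ #G' + (2 * T + 1) := by
      have : ((T : ℤ) + 1 - -(T : ℤ)).toNat = 2 * T + 1 := by omega
      rw [this] at h1
      exact_mod_cast h1
    linarith
  have hmaps : Set.MapsTo (fun a : ℤ => (a + N) / (l : ℤ)) G'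
      (Finset.Icc (0 : ℤ) (2 * N / l)) := by
    intro a ha
    have ha1 := abs_le.1 (hG a (Finset.mem_sdiff.1 ha).1)
    simp only [Finset.coe_Icc, Set.mem_Icc]
    exact ⟨Int.ediv_nonneg (by linarith) hlz.le, Int.ediv_le_ediv hlz (by linarith)⟩
  have hlt : #(Finset.Icc (0 : ℤ) (2 * N / l)) < #G' := by
    rw [Int.card_Icc]
    have h0 : (0 : ℤ) ≤ 2 * N / l := Int.ediv_nonneg (by positivity) hlz.le
    have h1 : (((2 * N / l + 1 - 0 : ℤ).toNat : ℕ) : ℝ) = ((2 * N / l : ℤ) : ℝ) + 1 := by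
      have : (((2 * N / l + 1 - 0 : ℤ).toNat : ℕ) : ℤ) = (2 * N / l : ℤ) + 1 := by
        rw [Int.toNat_of_nonneg (by linarith)]; ring
      exact_mod_cast this
    have h2 : ((2 * N / l : ℤ) : ℝ) ≤ g * N / 4 := by
      have h3 : ((2 * N / l : ℤ) : ℝ) * l ≤ 2 * N := by
        exact_mod_cast Int.ediv_mul_le (2 * N : ℤ) hlz.ne'
      have h4 : 8 ≤ l * g := by rwa [div_le_iff₀ hg] at hl1
      have h5 : (0 : ℝ) ≤ ((2 * N / l : ℤ) : ℝ) := by exact_mod_cast h0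
      nlinarith [mul_le_mul_of_nonneg_left h4 h5]
    have : (((2 * N / l + 1 - 0 : ℤ).toNat : ℕ) : ℝ) < #G' := by
      rw [h1]; linarith
    exact_mod_cast this
  obtain ⟨a, ha, a', ha', hne, heq⟩ := Finset.exists_ne_map_eq_of_card_lt_of_maps_to hlt hmaps
  refine ⟨a, (Finset.mem_sdiff.1 ha).1, a', (Finset.mem_sdiff.1 ha').1, hne, ?_, ?_⟩
  · refine le_trans ?_ hl2
    have h1 := Int.emod_add_mul_ediv (a + N) l
    have h2 := Int.emod_add_mul_ediv (a' + N) l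
    have h3 := Int.emod_lt_of_pos (a + N) hlz
    have h4 := Int.emod_lt_of_pos (a' + N) hlz
    have h5 := Int.emod_nonneg (a + N) hlz.ne'
    have h6 := Int.emod_nonneg (a' + N) hlz.ne'
    rw [heq] at h1
    have : |a - a'| ≤ (l : ℤ) := by
      rw [abs_le]; constructor <;> linarith
    exact_mod_cast this
  · have h1 := (Finset.mem_sdiff.1 ha).2
    rw [Finset.mem_Icc, ← abs_le, not_le] at h1
    have h2 : (T : ℤ) + 1 ≤ |a| := h1
    have h3 : (T : ℝ) + 1 ≤ |(a : ℝ)| := by exact_mod_cast h2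
    linarith [Nat.lt_floor_add_one (g * N / 8)]

/-- With d = gcd(a, a') and r = a/d, a fibre fixes v' modulo r, and v' fixes v, so it has at most
2S/|r| + 1 elements. Closeness enters through d ≤ |a − a'|. -/
lemma card_image_lin_comb_ge (V V' : Finset ℤ) (S : ℕ) (hV' : ∀ v ∈ V', |v| ≤ (S : ℤ)) {a a' : ℤ}
    (ha : a ≠ 0) (hne : a ≠ a') :
    (#V * #V' : ℝ) ≤ (2 * S * |((a - a' : ℤ) : ℝ)| / |(a : ℝ)| + 1) *
      #((V ×ˢ V').image fun p => a * p.1 + a' * p.2) := by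
  have hd0 : 0 < a.gcd a' := Int.gcd_pos_of_ne_zero_left _ ha
  set d : ℤ := ((a.gcd a' : ℕ) : ℤ) with hd
  have hdpos : 0 < d := Int.natCast_pos.2 hd0
  obtain ⟨r, hr⟩ : d ∣ a := Int.gcd_dvd_left _ _
  obtain ⟨r', hr'⟩ : d ∣ a' := Int.gcd_dvd_right _ _
  have hcop : IsCoprime r r' := by
    have h := Int.isCoprime_iff_gcd_eq_one.2 (Int.gcd_ediv_gcd_ediv_gcd hd0)
    rw [← hd] at h
    rwa [hr, hr', Int.mul_ediv_cancel_left _ hdpos.ne', Int.mul_ediv_cancel_left _ hdpos.ne'] at h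
  have hr0 : r ≠ 0 := by rintro rfl; exact ha (by rw [hr, mul_zero])
  have hrpos : 0 < |r| := abs_pos.2 hr0
  have hdle : d ≤ |a - a'| := by
    refine Int.le_of_dvd (abs_pos.2 (sub_ne_zero.2 hne)) ((dvd_abs _ _).2 ?_)
    exact dvd_sub ⟨r, hr⟩ ⟨r', hr'⟩
  have hfib : ∀ z ∈ (V ×ˢ V').image fun p => a * p.1 + a' * p.2,
      #{p ∈ V ×ˢ V' | a * p.1 + a' * p.2 = z} ≤ (2 * S / |r| + 1).toNat := by
    intro z _
    have hcard : #(Finset.Icc (0 : ℤ) (2 * S / |r|)) = (2 * S / |r| + 1).toNat := by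
      rw [Int.card_Icc]; simp
    rw [← hcard]
    refine Finset.card_le_card_of_injOn (fun p => (p.2 + S) / |r|) ?_ ?_
    · intro p hp
      have hp2 := abs_le.1 (hV' p.2 (Finset.mem_product.1 (Finset.mem_filter.1 hp).1).2)
      simp only [Finset.coe_Icc, Set.mem_Icc]
      exact ⟨Int.ediv_nonneg (by linarith) hrpos.le, Int.ediv_le_ediv hrpos (by linarith)⟩
    · intro p hp p' hp' heq
      have e1 := (Finset.mem_filter.1 hp).2
      have e2 := (Finset.mem_filter.1 hp').2
      have e3 : a * (p.1 - p'.1) = a' * (p'.2 - p.2) := by linarith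
      have e4 : r * (p.1 - p'.1) = r' * (p'.2 - p.2) := by
        refine mul_left_cancel₀ hdpos.ne' ?_
        rw [← mul_assoc, ← mul_assoc, ← hr, ← hr', e3]
      have e5 : r ∣ p'.2 - p.2 := hcop.dvd_of_dvd_mul_left ⟨_, e4.symm⟩
      have h1 := Int.emod_add_mul_ediv (p.2 + S) |r|
      have h2 := Int.emod_add_mul_ediv (p'.2 + S) |r|
      have h3 := Int.emod_lt_of_pos (p.2 + S) hrpos
      have h4 := Int.emod_lt_of_pos (p'.2 + S) hrpos
      have h5 := Int.emod_nonneg (p.2 + S) hrpos.ne'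
      have h6 := Int.emod_nonneg (p'.2 + S) hrpos.ne'
      simp only at heq
      rw [heq] at h1
      have e6 : p'.2 - p.2 = 0 := by
        refine Int.eq_zero_of_abs_lt_dvd ((abs_dvd _ _).2 e5) ?_
        rw [abs_lt]; constructor <;> linarith
      have e7 : p.1 - p'.1 = 0 := by
        rw [e6, mul_zero] at e3
        exact (mul_eq_zero.1 e3).resolve_left ha
      exact Prod.ext (by linarith) (by linarith)
  have hmain := Finset.card_le_mul_card_image (V ×ˢ V') _ hfib
  rw [Finset.card_product] at hmain
  have hq0 : (0 : ℤ) ≤ 2 * S / |r| := Int.ediv_nonneg (by positivity) hrpos.le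
  have hcast : (((2 * S / |r| + 1).toNat : ℕ) : ℝ) = ((2 * S / |r| : ℤ) : ℝ) + 1 := by
    have : (((2 * S / |r| + 1).toNat : ℕ) : ℤ) = (2 * S / |r| : ℤ) + 1 :=
      Int.toNat_of_nonneg (by linarith)
    exact_mod_cast this
  have hbound : ((2 * S / |r| : ℤ) : ℝ) ≤ 2 * S * |((a - a' : ℤ) : ℝ)| / |(a : ℝ)| := by
    have ha0 : 0 < |(a : ℝ)| := abs_pos.2 (by exact_mod_cast ha)
    rw [le_div_iff₀ ha0]
    have h1 : (2 * S / |r| : ℤ) * |a| ≤ 2 * S * |a - a'| := by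
      rw [hr, abs_mul, abs_of_pos hdpos]
      calc (2 * S / |r| : ℤ) * (d * |r|) = ((2 * S / |r| : ℤ) * |r|) * d := by ring
        _ ≤ (2 * S) * d := mul_le_mul_of_nonneg_right (Int.ediv_mul_le _ hrpos.ne') hdpos.le
        _ ≤ _ := by
          rw [← hr]
          exact mul_le_mul_of_nonneg_left hdle (by positivity)
    exact_mod_cast h1
  calc (#V * #V' : ℝ) ≤ (((2 * S / |r| + 1).toNat : ℕ) : ℝ) *
        #((V ×ˢ V').image fun p => a * p.1 + a' * p.2) := by exact_mod_cast hmain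
    _ ≤ _ := by
      rw [hcast]
      exact mul_le_mul_of_nonneg_right (by linarith) (Nat.cast_nonneg _)

end RestrictedDigits

namespace RestrictedDigits

open Finset
open scoped BigOperators Pointwise

/-! ### Additive expansion of products -/

lemma card_Icc_neg_le (S : ℕ) (hS : 1 ≤ S) : (#(Finset.Icc (-(S : ℤ)) S) : ℝ) ≤ 3 * S := by
  rw [Int.card_Icc]
  have : ((S : ℤ) + 1 - -(S : ℤ)).toNat = 2 * S + 1 := by omega
  rw [this]
  have : (1 : ℝ) ≤ S := by exact_mod_cast hS
  push_cast
  linarith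

/-- Exchanges the roles of y and v: for a value v lying in many of the sets `V y`,
`exists_many_sums` applies to a ↦ w(av). -/
lemma exists_popular_multipliers {B q S : ℕ} (hB : 2 ≤ B) (hS : 1 ≤ S) (w : ℤ → ℝ) (hw0 : w 0 ≤ 0)
    (hw : ∀ x y, w (x + y) ≤ w x + w y) (y' : Fin q → Fin 2) {R : ℝ} (hR : 0 ≤ R)
    (G : Finset (Fin q → Fin 2)) (V : (Fin q → Fin 2) → Finset ℤ)
    (hV : ∀ y ∈ G, ∀ v ∈ V y, |v| ≤ (S : ℤ) ∧ w ((bitValue B y - bitValue B y') * v) ≤ R)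
    {ρ τ Y : ℝ} (hτ : 0 ≤ τ) (hE : ρ * 2 ^ q * Y ≤ ∑ y ∈ G, (#(V y) : ℝ))
    (hτρ : 3 * S * τ ≤ ρ * Y / 2) :
    ∃ (Vs : Finset ℤ) (W : ℤ → Finset ℤ), ρ * Y / 2 ≤ #Vs ∧ ∀ v ∈ Vs, |v| ≤ (S : ℤ) ∧
      τ ^ (B - 1) * (B : ℝ) ^ q ≤ #(W v) ∧ ∀ a ∈ W v, |a| ≤ (B : ℤ) ^ q ∧ w (a * v) ≤ B * R := by
  have h := card_popular_ge G (Finset.Icc (-(S : ℤ)) S) V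
    (fun y hy v hv => by rw [Finset.mem_Icc, ← abs_le]; exact (hV y hy v hv).1)
    (E := ρ * 2 ^ q * Y) (τ := τ * 2 ^ q) (by positivity) hE (by
      have h1 := card_Icc_neg_le S hS
      have h2 : (0 : ℝ) < 2 ^ q := by positivity
      calc (#(Finset.Icc (-(S : ℤ)) S) : ℝ) * (τ * 2 ^ q) ≤ 3 * S * (τ * 2 ^ q) := by gcongr
        _ = 3 * S * τ * 2 ^ q := by ring
        _ ≤ ρ * Y / 2 * 2 ^ q := by gcongr
        _ = _ := by ring)
  set Vs := (Finset.Icc (-(S : ℤ)) S).filter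
    fun v => τ * 2 ^ q ≤ (#(G.filter fun y => v ∈ V y) : ℝ) with hVs
  have hW : ∀ v, ∃ W : Finset ℤ, v ∈ Vs → τ ^ (B - 1) * (B : ℝ) ^ q ≤ #W ∧
      ∀ a ∈ W, |a| ≤ (B : ℤ) ^ q ∧ w (a * v) ≤ B * R := by
    intro v
    by_cases hv : v ∈ Vs
    · obtain ⟨W, h1, h2⟩ := exists_many_sums hB (G.filter fun y => v ∈ V y) hτ
        (Finset.mem_filter.1 hv).2 (fun a => w (a * v)) (by simpa using hw0)
        (fun x y => by rw [add_mul]; exact hw _ _) y' hR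
        (fun y hy => (hV y (Finset.mem_filter.1 hy).1 v (Finset.mem_filter.1 hy).2).2)
      exact ⟨W, fun _ => ⟨h1, h2⟩⟩
    -- Multipliers matter only on `Vs`; the empty set is a default elsewhere.
    · exact ⟨∅, fun h => absurd h hv⟩
  choose W hW using hW
  refine ⟨Vs, W, ?_, fun v hv => ⟨?_, hW v hv⟩⟩
  · have h1 : (#G : ℝ) ≤ 2 ^ q := by
      have := Finset.card_le_univ G
      simp only [Fintype.card_pi, Fintype.card_fin, Finset.prod_const, Finset.card_univ] at this
      exact_mod_cast this
    refine le_of_mul_le_mul_left ?_ (show (0 : ℝ) < 2 ^ q by positivity)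
    calc 2 ^ q * (ρ * Y / 2) = ρ * 2 ^ q * Y / 2 := by ring
      _ ≤ #G * #Vs := h
      _ ≤ 2 ^ q * #Vs := by gcongr
  · rw [abs_le, ← Finset.mem_Icc]
    exact (Finset.mem_filter.1 hv).1

/-- Popular multipliers are dense enough to contain a close pair a ≠ a' with a large; the
combinations av + a'v' then have small fibres. -/
lemma exists_many_lin_comb {N S : ℕ} (hN : 1 ≤ N) (hS : 1 ≤ S) (w : ℤ → ℝ)
    (hw : ∀ x y, w (x + y) ≤ w x + w y) {R : ℝ} (Vs : Finset ℤ) (W : ℤ → Finset ℤ)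
    (hV : ∀ v ∈ Vs, |v| ≤ (S : ℤ)) (hW : ∀ v ∈ Vs, ∀ a ∈ W v, |a| ≤ (N : ℤ) ∧ w (a * v) ≤ R)
    {E t g : ℝ} (hE : E ≤ ∑ v ∈ Vs, (#(W v) : ℝ)) (ht : 0 ≤ t) (htE : 3 * N * t ≤ E / 2)
    (hg : 0 < g) (hg1 : g ≤ 1) (hgE : g * N * (3 * S) ≤ E / 2) (hgN : 16 ≤ g * N) :
    ∃ V : Finset ℤ, t ^ 2 ≤ (144 * S / (g ^ 2 * N) + 1) * #V ∧
      ∀ m ∈ V, |m| ≤ 2 * (N * S : ℤ) ∧ w m ≤ 2 * R := by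
  have h := card_popular_ge Vs (Finset.Icc (-(N : ℤ)) N) W
    (fun v hv a ha => by rw [Finset.mem_Icc, ← abs_le]; exact (hW v hv a ha).1) ht hE (by
      refine le_trans ?_ htE
      gcongr
      exact card_Icc_neg_le N hN)
  set G := (Finset.Icc (-(N : ℤ)) N).filter
    fun a => t ≤ (#(Vs.filter fun v => a ∈ W v) : ℝ) with hG
  have hS0 : (0 : ℝ) < S := by exact_mod_cast hS
  have hN0 : (0 : ℝ) < N := by exact_mod_cast hN
  have hVs : (#Vs : ℝ) ≤ 3 * S := by
    refine le_trans ?_ (card_Icc_neg_le S hS)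
    exact_mod_cast Finset.card_le_card fun v hv => by
      rw [Finset.mem_Icc, ← abs_le]; exact hV v hv
  have hGc : g * N ≤ #G := by
    refine le_of_mul_le_mul_left ?_ (show (0 : ℝ) < 3 * S by positivity)
    calc 3 * S * (g * N) = g * N * (3 * S) := by ring
      _ ≤ E / 2 := hgE
      _ ≤ #Vs * #G := h
      _ ≤ 3 * S * #G := by gcongr
  obtain ⟨a, ha, a', ha', hne, hclose, hbig⟩ := exists_close_pair G N hg hg1 hgN
    (fun a ha => by rw [abs_le, ← Finset.mem_Icc]; exact (Finset.mem_filter.1 ha).1) hGc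
  have ha0 : a ≠ 0 := by
    rintro rfl
    simp only [Int.cast_zero, abs_zero] at hbig
    linarith
  have hcard := card_image_lin_comb_ge (Vs.filter fun v => a ∈ W v) (Vs.filter fun v => a' ∈ W v) S
    (fun v hv => hV v (Finset.mem_filter.1 hv).1) ha0 hne
  refine ⟨((Vs.filter fun v => a ∈ W v) ×ˢ (Vs.filter fun v => a' ∈ W v)).image
    fun p => a * p.1 + a' * p.2, ?_, ?_⟩
  · refine le_trans ?_ (hcard.trans ?_)
    · rw [sq]
      exact mul_le_mul (Finset.mem_filter.1 ha).2 (Finset.mem_filter.1 ha').2 ht (Nat.cast_nonneg _)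
    · refine mul_le_mul_of_nonneg_right ?_ (Nat.cast_nonneg _)
      have h1 : 2 * S * |((a - a' : ℤ) : ℝ)| / |(a : ℝ)| ≤ 2 * S * (9 / g) / (g * N / 8) := by
        gcongr
      have h2 : 2 * S * (9 / g) / (g * N / 8) = 144 * S / (g ^ 2 * N) := by
        field_simp
        norm_num
      linarith
  · intro m hm
    obtain ⟨⟨v, v'⟩, hp, rfl⟩ := Finset.mem_image.1 hm
    obtain ⟨hv, hv'⟩ := Finset.mem_product.1 hp
    obtain ⟨hv1, hv2⟩ := Finset.mem_filter.1 hv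
    obtain ⟨hv1', hv2'⟩ := Finset.mem_filter.1 hv'
    obtain ⟨b1, b2⟩ := hW v hv1 a hv2
    obtain ⟨b1', b2'⟩ := hW v' hv1' a' hv2'
    refine ⟨?_, (hw _ _).trans (by linarith)⟩
    refine (abs_add_le _ _).trans ?_
    rw [abs_mul, abs_mul, two_mul]
    exact add_le_add (mul_le_mul b1 (hV v hv1) (abs_nonneg _) (by positivity))
      (mul_le_mul b1' (hV v' hv1') (abs_nonneg _) (by positivity))

end RestrictedDigits

/-! ### Induction on the number of factors -/

namespace RestrictedDigits

open Finset
open scoped BigOperators Pointwise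

/-- Lets powers of x ≤ 1/2 absorb numerical constants. -/
lemma mul_two_pow_mul_pow_le (c j K : ℕ) (hc : c ≤ 2 ^ j) {x : ℝ} (hx0 : 0 ≤ x) (hx : x ≤ 1 / 2) :
    c * 2 ^ K * x ^ (j + K) ≤ 1 := by
  have hc' : (c : ℝ) ≤ 2 ^ j := by exact_mod_cast hc
  calc (c : ℝ) * 2 ^ K * x ^ (j + K) ≤ 2 ^ j * 2 ^ K * x ^ (j + K) := by gcongr
    _ = (2 * x) ^ (j + K) := by rw [mul_pow, ← pow_add]
    _ ≤ 1 := pow_le_one₀ (by positivity) (by linarith)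

lemma exponent_bound {p K e : ℕ} (he : 16 * (p + 1) * (K + 1) ≤ e) :
    4 * (2 * e + 2 + (2 * e + K + 4) * p) + 3 * K + 19 ≤ 16 * (p + 1) * e := by
  have h1 : 16 * (K + 1) ≤ e := by nlinarith
  have h2 : p * (16 * (K + 1)) ≤ p * e := Nat.mul_le_mul_left p h1
  nlinarith

/-- The step from products of `K + 1` factors to products of `K + 2` factors. -/
lemma expansion_step {p q K e : ℕ} (he : 16 * (p + 1 + 1) * (K + 1) ≤ e) (w : ℤ → ℝ) (hw0 : w 0 ≤ 0)
    (hw : ∀ x y, w (x + y) ≤ w x + w y) (y' : Fin q → Fin 2) {R : ℝ} (hR : 0 ≤ R)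
    (G : Finset (Fin q → Fin 2)) (V : (Fin q → Fin 2) → Finset ℤ)
    (hV : ∀ y ∈ G, ∀ v ∈ V y, |v| ≤ 2 ^ K * (((p + 2) ^ q : ℕ) : ℤ) ^ (K + 1) ∧
      w ((bitValue (p + 2) y - bitValue (p + 2) y') * v) ≤ R)
    {x : ℝ} (hx0 : 0 < x) (hx : x ≤ 1 / 2) (hG : x * 2 ^ q ≤ #G)
    (hcard : ∀ y ∈ G, x ^ (2 * e) * (((p + 2) ^ q : ℕ) : ℝ) ^ (K + 1) ≤ #(V y))
    (hN : 1 ≤ x ^ (16 * (p + 1 + 1) * e) * (((p + 2) ^ q : ℕ) : ℝ)) :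
    ∃ V : Finset ℤ, x ^ (16 * (p + 1 + 1) * e) * (((p + 2) ^ q : ℕ) : ℝ) ^ (K + 2) ≤ #V ∧
      ∀ m ∈ V, |m| ≤ 2 ^ (K + 1) * (((p + 2) ^ q : ℕ) : ℤ) ^ (K + 2) ∧
        w m ≤ 2 * (((p + 2 : ℕ) : ℝ) * R) := by
  set N : ℕ := (p + 2) ^ q with hNdef
  have hN1 : 1 ≤ N := Nat.one_le_pow _ _ (by omega)
  have hN1' : (1 : ℝ) ≤ N := by exact_mod_cast hN1
  set Y : ℝ := (N : ℝ) ^ (K + 1) with hY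
  have hNY : (N : ℝ) ≤ Y := le_self_pow₀ hN1' (by omega)
  have hY0 : 0 < Y := by linarith
  set s : ℝ := 2 ^ K with hs
  have hs1 : 1 ≤ s := one_le_pow₀ (by norm_num)
  have hx1 : x ≤ 1 := by linarith
  set S : ℕ := 2 ^ K * N ^ (K + 1) with hSdef
  have hS : 1 ≤ S := Nat.one_le_iff_ne_zero.2 (by positivity)
  have hSR : (S : ℝ) = s * Y := by rw [hSdef]; push_cast; rfl
  have hSZ : (S : ℤ) = 2 ^ K * (N : ℤ) ^ (K + 1) := by rw [hSdef]; push_cast; rfl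
  -- ρ combines the density x of `G` with the factor x^(2e) from `V y`; τ is smaller by x^(K+3),
  -- which pays for the factor 6 · 2^K in `hτρ`.
  set ρ : ℝ := x ^ (2 * e + 1) with hρ
  set τ : ℝ := x ^ (2 * e + K + 4) with hτ
  have hτρ : 3 * S * τ ≤ ρ * Y / 2 := by
    have h1 := mul_two_pow_mul_pow_le 6 3 K (by norm_num) hx0.le hx
    have h2 : τ = ρ * x ^ (3 + K) := by rw [hτ, hρ, ← pow_add]; congr 1; ring
    rw [hSR, h2]
    have h3 : 0 ≤ ρ * Y := by positivity
    push_cast at h1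
    nlinarith [mul_le_mul_of_nonneg_left h1 h3]
  obtain ⟨Vs, W, hVs, hW⟩ := exists_popular_multipliers (B := p + 2) (by omega) hS w hw0 hw y' hR G V
    (fun y hy v hv => by rw [hSZ]; exact hV y hy v hv) (ρ := ρ) (τ := τ) (Y := Y) (by positivity) (by
      calc ρ * 2 ^ q * Y = (x * 2 ^ q) * (x ^ (2 * e) * Y) := by rw [hρ]; ring
        _ ≤ #G * (x ^ (2 * e) * Y) := by gcongr
        _ ≤ _ := by
          rw [← nsmul_eq_mul]
          exact Finset.card_nsmul_le_sum _ _ _ hcard) hτρ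
  -- There are at least σNY pairs (v, a), as p + 1 = B − 1. The choice of g below makes g * N * (3 *
  -- S) exactly half of this.
  set σ : ℝ := ρ / 2 * τ ^ (p + 1) with hσ
  set g : ℝ := σ / (6 * s) with hg
  set E₀ : ℕ := 2 * e + 2 + (2 * e + K + 4) * (p + 1) with hE₀
  have hexp := exponent_bound he
  rw [← hE₀] at hexp
  have hσlow : x ^ E₀ ≤ σ := by
    have h1 : x ^ E₀ = ρ * x * τ ^ (p + 1) := by
      rw [hρ, hτ, ← pow_mul, ← pow_succ, ← pow_add]
    rw [h1, hσ]
    have : ρ * x ≤ ρ / 2 := by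
      have : 0 < ρ := by positivity
      nlinarith
    gcongr
  have hσ0 : 0 < σ := by positivity
  have hglow : x ^ (E₀ + K + 3) ≤ g := by
    rw [hg, le_div_iff₀ (by positivity)]
    have h1 := mul_two_pow_mul_pow_le 6 3 K (by norm_num) hx0.le hx
    calc x ^ (E₀ + K + 3) * (6 * s) = x ^ E₀ * ((6 : ℕ) * 2 ^ K * x ^ (3 + K)) := by
          rw [hs]; push_cast; ring
      _ ≤ x ^ E₀ * 1 := by gcongr
      _ ≤ σ := by rw [mul_one]; exact hσlow
  have hg0 : 0 < g := by positivity
  have hg1 : g ≤ 1 := by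
    rw [hg, div_le_one (by positivity)]
    have h1 : ρ ≤ 1 := pow_le_one₀ hx0.le hx1
    have h2 : τ ^ (p + 1) ≤ 1 := pow_le_one₀ (by positivity) (pow_le_one₀ hx0.le hx1)
    have h3 : 0 ≤ τ ^ (p + 1) := by positivity
    have h4 : σ ≤ 1 := by rw [hσ]; nlinarith
    linarith
  have hgN : 16 ≤ g * N := by
    have h1 : 16 * x ^ (16 * (p + 1 + 1) * e) ≤ g := by
      refine le_trans ?_ hglow
      have h2 := mul_two_pow_mul_pow_le 16 4 0 (by norm_num) hx0.le hx
      calc 16 * x ^ (16 * (p + 1 + 1) * e) ≤ 16 * x ^ (E₀ + K + 3 + 4) := by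
            refine mul_le_mul_of_nonneg_left ?_ (by norm_num)
            exact pow_le_pow_of_le_one hx0.le hx1 (by omega)
        _ = x ^ (E₀ + K + 3) * ((16 : ℕ) * 2 ^ 0 * x ^ (4 + 0)) := by push_cast; ring
        _ ≤ x ^ (E₀ + K + 3) * 1 := by gcongr
        _ = _ := mul_one _
    calc (16 : ℝ) ≤ 16 * (x ^ (16 * (p + 1 + 1) * e) * N) := by linarith
      _ = (16 * x ^ (16 * (p + 1 + 1) * e)) * N := by ring
      _ ≤ g * N := by gcongr
  obtain ⟨V', hV'1, hV'2⟩ := exists_many_lin_comb hN1 hS w hw Vs W (fun v hv => (hW v hv).1)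
    (fun v hv a ha => by
      have := (hW v hv).2.2 a ha
      refine ⟨?_, this.2⟩
      rw [hNdef]; push_cast
      simpa using this.1) (R := ((p + 2 : ℕ) : ℝ) * R) (E := σ * N * Y) (t := σ * Y / 6) (g := g) (by
      calc σ * N * Y = (ρ * Y / 2) * (τ ^ (p + 1) * N) := by rw [hσ]; ring
        _ ≤ #Vs * (τ ^ (p + 1) * N) := by gcongr
        _ ≤ _ := by
          rw [← nsmul_eq_mul]
          refine Finset.card_nsmul_le_sum _ _ _ fun v hv => ?_
          have h := (hW v hv).2.1
          rw [hNdef]; push_cast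
          simpa using h) (by positivity) (by linarith) hg0 hg1 (by
      rw [hSR, hg]
      apply le_of_eq
      field_simp
      norm_num) hgN
  refine ⟨V', ?_, fun m hm => ?_⟩
  -- A bound for the fibre size: the summand 1 is absorbed by raising 144 to 145. Below, 5220 = 145
  -- · 36, with 36 from t² = (σY/6)².
  · set M : ℝ := 145 * s * Y / (g ^ 2 * N) with hM
    have hM0 : 0 < M := by positivity
    have h1 : 144 * (S : ℝ) / (g ^ 2 * N) + 1 ≤ M := by
      have h2 : 1 ≤ s * Y / (g ^ 2 * N) := by
        rw [le_div_iff₀ (by positivity), one_mul]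
        have : g ^ 2 ≤ 1 := pow_le_one₀ hg0.le hg1
        nlinarith
      have h3 : M = 144 * (s * Y) / (g ^ 2 * N) + s * Y / (g ^ 2 * N) := by rw [hM]; ring
      rw [h3, hSR]; linarith
    have h2 : x ^ (16 * (p + 1 + 1) * e) * (5220 * s) ≤ σ ^ 2 * g ^ 2 := by
      have h3 := mul_two_pow_mul_pow_le 5220 13 K (by norm_num) hx0.le hx
      calc x ^ (16 * (p + 1 + 1) * e) * (5220 * s)
          ≤ x ^ (4 * E₀ + 3 * K + 19) * (5220 * s) := by
            refine mul_le_mul_of_nonneg_right ?_ (by positivity)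
            exact pow_le_pow_of_le_one hx0.le hx1 hexp
        _ = (x ^ E₀) ^ 2 * (x ^ (E₀ + K + 3)) ^ 2 * ((5220 : ℕ) * 2 ^ K * x ^ (13 + K)) := by
            rw [hs]; push_cast; ring
        _ ≤ (x ^ E₀) ^ 2 * (x ^ (E₀ + K + 3)) ^ 2 * 1 := by gcongr
        _ ≤ _ := by rw [mul_one]; gcongr
    refine le_of_mul_le_mul_left ?_ hM0
    calc M * (x ^ (16 * (p + 1 + 1) * e) * (N : ℝ) ^ (K + 2))
        = (x ^ (16 * (p + 1 + 1) * e) * (5220 * s)) * (Y ^ 2 / (36 * g ^ 2)) := by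
          rw [hM, pow_succ (N : ℝ) (K + 1), ← hY]
          field_simp
          norm_num
      _ ≤ (σ ^ 2 * g ^ 2) * (Y ^ 2 / (36 * g ^ 2)) := by gcongr
      _ = (σ * Y / 6) ^ 2 := by field_simp; norm_num
      _ ≤ (144 * S / (g ^ 2 * N) + 1) * #V' := hV'1
      _ ≤ M * #V' := by gcongr
  · obtain ⟨h1, h2⟩ := hV'2 m hm
    refine ⟨h1.trans_eq ?_, h2⟩
    rw [hSZ]; ring

/-- Allowing any subadditive w lets the induction hypothesis act on m ↦ w((L(y) − L(y'₀))m) for each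
fixed first coordinate y; `expansion_step` merges the resulting sets, multiplying the exponent by
16B. -/
theorem exists_expansion {B q : ℕ} (hB : 2 ≤ B) (K : ℕ) (w : ℤ → ℝ) (hw0 : w 0 ≤ 0)
    (hw : ∀ x y, w (x + y) ≤ w x + w y) (y' : Fin (K + 1) → Fin q → Fin 2) {R : ℝ} (hR : 0 ≤ R)
    (T : Finset (Fin (K + 1) → Fin q → Fin 2))
    (hT : ∀ y ∈ T, w (∏ j, (bitValue B (y j) - bitValue B (y' j))) ≤ R)
    {η : ℝ} (hη : 0 < η) (hη1 : η ≤ 1) (hcard : η * (2 ^ q) ^ (K + 1) ≤ #T)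
    (hN : (2 / η) ^ ((16 * B) ^ (K + 1)) ≤ ((B ^ q : ℕ) : ℝ)) :
    ∃ V : Finset ℤ, (η / 2) ^ ((16 * B) ^ (K + 1)) * ((B ^ q : ℕ) : ℝ) ^ (K + 1) ≤ #V ∧
      ∀ m ∈ V, |m| ≤ 2 ^ K * ((B ^ q : ℕ) : ℤ) ^ (K + 1) ∧ w m ≤ (2 * B) ^ K * (B * R) := by
  induction K generalizing w R η with
  | zero =>
    have hinj : Function.Injective fun y : Fin 1 → Fin q → Fin 2 => y 0 := by
      intro y z h
      funext i
      rw [Subsingleton.elim i 0]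
      exact h
    obtain ⟨V, h1, h2⟩ := exists_many_sums hB (T.image fun y => y 0) hη.le
      (by rw [Finset.card_image_of_injective _ hinj]; simpa using hcard) w hw0 hw (y' 0) hR
      (by
        simp only [Finset.mem_image]
        rintro _ ⟨y, hy, rfl⟩
        simpa using hT y hy)
    refine ⟨V, le_trans ?_ h1, fun m hm => ?_⟩
    · have h3 : (η / 2) ^ ((16 * B) ^ (0 + 1)) ≤ η ^ (B - 1) :=
        (pow_le_pow_left₀ (by positivity) (by linarith) _).trans
          (pow_le_pow_of_le_one hη.le hη1 (by rw [zero_add, pow_one]; omega))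
      push_cast
      rw [pow_one ((B : ℝ) ^ q)]
      gcongr
    · have := h2 m hm
      refine ⟨by simpa using this.1, by simpa using this.2⟩
  | succ K ih =>
    classical
    set e := (16 * B) ^ (K + 1) with he
    have hexp : (16 * B) ^ (K + 1 + 1) = 16 * B * e := by rw [pow_succ, ← he, mul_comm]
    rw [hexp] at hN ⊢
    set x := η / 2 with hx
    have hx0 : 0 < x := by positivity
    have hx2 : x ≤ 1 / 2 := by linarith
    have hinv : 2 / η = x⁻¹ := by rw [hx]; field_simp
    have hinv2 : 2 / x ≤ (2 / η) ^ 2 := by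
      rw [hinv, div_le_iff₀ hx0]
      have h1 : (2 : ℝ) ≤ x⁻¹ := by rw [le_inv_comm₀ (by norm_num) hx0]; linarith
      calc (2 : ℝ) ≤ x⁻¹ := h1
        _ = x⁻¹ ^ 2 * x := by field_simp
    have hNe : (2 / x) ^ e ≤ ((B ^ q : ℕ) : ℝ) := by
      refine le_trans ?_ hN
      calc (2 / x) ^ e ≤ ((2 / η) ^ 2) ^ e := by gcongr
        _ = (2 / η) ^ (2 * e) := by rw [pow_mul]
        _ ≤ (2 / η) ^ (16 * B * e) := by
          refine pow_le_pow_right₀ ?_ ?_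
          · rw [le_div_iff₀ hη]; linarith
          · exact Nat.mul_le_mul_right e (by omega)
    -- First coordinates whose fibre in T has at least half the density η; the nested filter matches
    -- `card_popular_ge`.
    set G : Finset (Fin q → Fin 2) := univ.filter fun y => x * (2 ^ q) ^ (K + 1) ≤
      (#(univ.filter fun z : Fin (K + 1) → Fin q → Fin 2 =>
        y ∈ univ.filter fun y => (Fin.cons y z : Fin (K + 2) → Fin q → Fin 2) ∈ T) : ℝ) with hG
    have hGcard : x * 2 ^ q ≤ #G := by
      have hTsum : (#T : ℝ) = ∑ z : Fin (K + 1) → Fin q → Fin 2,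
          (#(univ.filter fun y => (Fin.cons y z : Fin (K + 2) → Fin q → Fin 2) ∈ T) : ℝ) := by
        have h1 : (#T : ℝ) = ∑ z : Fin (K + 2) → Fin q → Fin 2, if z ∈ T then (1 : ℝ) else 0 := by
          simp
        rw [h1, ← (Fin.consEquiv fun _ => Fin q → Fin 2).sum_comp, Fintype.sum_prod_type_right]
        refine Finset.sum_congr rfl fun z _ => ?_
        rw [Finset.sum_boole]
        rfl
      have h := card_popular_ge (univ : Finset (Fin (K + 1) → Fin q → Fin 2)) univ
        (fun z => univ.filter fun y => (Fin.cons y z : Fin (K + 2) → Fin q → Fin 2) ∈ T)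
        (fun _ _ => Finset.subset_univ _) (E := η * (2 ^ q) ^ (K + 2))
        (τ := x * (2 ^ q) ^ (K + 1)) (by positivity) (hcard.trans_eq hTsum) (by
          simp only [Finset.card_univ, Fintype.card_pi, Fintype.card_fin, Finset.prod_const]
          push_cast
          rw [hx]
          apply le_of_eq
          ring)
      rw [← hG] at h
      simp only [Finset.card_univ, Fintype.card_pi, Fintype.card_fin, Finset.prod_const] at h
      push_cast at h
      refine le_of_mul_le_mul_left ?_ (show (0 : ℝ) < (2 ^ q) ^ (K + 1) by positivity)
      refine le_trans (le_of_eq ?_) h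
      rw [hx]; ring
    have hfib : ∀ y, ∃ V : Finset ℤ, y ∈ G → x ^ (2 * e) * ((B ^ q : ℕ) : ℝ) ^ (K + 1) ≤ #V ∧
        ∀ m ∈ V, |m| ≤ 2 ^ K * ((B ^ q : ℕ) : ℤ) ^ (K + 1) ∧
          w ((bitValue B y - bitValue B (y' 0)) * m) ≤ (2 * B) ^ K * (B * R) := by
      intro y
      by_cases hy : y ∈ G
      · obtain ⟨V, h1, h2⟩ := ih (fun m => w ((bitValue B y - bitValue B (y' 0)) * m))
          (by simpa using hw0) (fun a b => by rw [mul_add]; exact hw _ _) (fun j => y' j.succ) hR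
          (univ.filter fun z : Fin (K + 1) → Fin q → Fin 2 =>
            y ∈ univ.filter fun y => (Fin.cons y z : Fin (K + 2) → Fin q → Fin 2) ∈ T)
          (fun z hz => by
            have h := hT _ (Finset.mem_filter.1 (Finset.mem_filter.1 hz).2).2
            rw [Fin.prod_univ_succ] at h
            simpa using h) hx0 (by linarith) (Finset.mem_filter.1 hy).2 hNe
        refine ⟨V, fun _ => ⟨le_trans ?_ h1, h2⟩⟩
        gcongr
        rw [pow_mul]
        -- Here x² ≤ x / 2, so the bound becomes a pure power of x.
        exact pow_le_pow_left₀ (by positivity) (by nlinarith) _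
      · exact ⟨∅, fun h => absurd h hy⟩
    choose V hV using hfib
    obtain ⟨p, rfl⟩ : ∃ p, B = p + 2 := ⟨B - 2, by omega⟩
    have hele : 16 * (p + 1 + 1) * (K + 1) ≤ e := by
      have h2 : K + 1 ≤ (16 * (p + 2)) ^ K := Nat.lt_pow_self (by omega)
      rw [he, pow_succ, mul_comm]
      exact Nat.mul_le_mul_right _ h2
    obtain ⟨V', h1, h2⟩ := expansion_step hele w hw0 hw (y' 0)
      (R := (2 * ((p + 2 : ℕ) : ℝ)) ^ K * (((p + 2 : ℕ) : ℝ) * R)) (by positivity) G V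
      (fun y hy => (hV y hy).2) hx0 hx2 hGcard (fun y hy => (hV y hy).1) (by
        rw [hinv, inv_pow] at hN
        rw [mul_comm, ← inv_le_iff_one_le_mul₀ (by positivity)]
        exact hN)
    refine ⟨V', h1, fun m hm => ⟨(h2 m hm).1, (h2 m hm).2.trans_eq ?_⟩⟩
    rw [pow_succ]; ring

end RestrictedDigits

namespace RestrictedDigits

open Finset
open scoped BigOperators

/-! ### The Fourier transform as an average over a product of cubes -/

/-- The integer with base `b` digits `d₁` or `d₂`, as prescribed by `y`. -/
def twoDigitValue (b d₁ d₂ : ℕ) {n : ℕ} (y : Fin n → Fin 2) : ℤ :=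
  digitValue b fun i => if y i = 0 then d₁ else d₂

lemma twoDigitValue_eq (b d₁ d₂ : ℕ) {n : ℕ} (y : Fin n → Fin 2) :
    twoDigitValue b d₁ d₂ y =
      digitValue b (fun _ : Fin n => d₁) + ((d₂ : ℤ) - d₁) * bitValue b y := by
  simp only [twoDigitValue, bitValue, digitValue, Finset.mul_sum, ← Finset.sum_add_distrib]
  refine Finset.sum_congr rfl fun i _ => ?_
  have h : y i = 0 ∨ y i = 1 := by omega
  rcases h with h | h <;> simp [h]
  ring

lemma twoDigitValue_pow_injective {b k d₁ d₂ : ℕ} (hk : k ≠ 0) (hd₁ : d₁ < b) (hd₂ : d₂ < b)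
    (hne : d₁ ≠ d₂) (n : ℕ) :
    Function.Injective fun y : Fin n → Fin 2 => twoDigitValue b d₁ d₂ y ^ k := by
  intro y z h
  have h1 : twoDigitValue b d₁ d₂ y = twoDigitValue b d₁ d₂ z :=
    (pow_left_inj₀ (digitValue_nonneg _ _) (digitValue_nonneg _ _) hk).1 h
  have hlt (y : Fin n → Fin 2) (i : Fin n) : (if y i = 0 then d₁ else d₂) < b := by
    split_ifs <;> assumption
  have h2 := digitValue_injective _ _ (hlt y) (hlt z) h1
  funext i
  have h3 := congrFun h2 i
  split_ifs at h3 with ha hb hb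
  · rw [ha, hb]
  · exact absurd h3 hne
  · exact absurd h3.symm hne
  · omega

lemma isDigitPower_iff {b k d₁ d₂ n : ℕ} {m : ℤ} :
    IsDigitPower b k d₁ d₂ n m ↔ ∃ y : Fin n → Fin 2, twoDigitValue b d₁ d₂ y ^ k = m := by
  classical
  constructor
  · rintro ⟨x, hx, rfl⟩
    refine ⟨fun i => if x i = d₁ then 0 else 1, ?_⟩
    rw [twoDigitValue, digitValue]
    congr 1
    refine Finset.sum_congr rfl fun i _ => ?_
    congr 2
    by_cases h : x i = d₁
    · simp [h]
    · simpa [h] using ((hx i).resolve_left h).symm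
  · rintro ⟨y, rfl⟩
    refine ⟨fun i => if y i = 0 then d₁ else d₂, fun i => ?_, rfl⟩
    by_cases h : y i = 0 <;> simp [h]

/-- Distinct digit strings have distinct k-th powers, so μ_n is uniform on 2^n atoms. -/
lemma muHat_eq {b k d₁ d₂ : ℕ} (hk : k ≠ 0) (hd₁ : d₁ < b) (hd₂ : d₂ < b) (hne : d₁ ≠ d₂) (n : ℕ)
    (θ : ℝ) : muHat b k d₁ d₂ n θ =
      𝔼 y : Fin n → Fin 2, expPhase (θ * (twoDigitValue b d₁ d₂ y : ℝ) ^ k) := by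
  classical
  have hinj := twoDigitValue_pow_injective hk hd₁ hd₂ hne n
  rw [muHat, tsum_eq_sum (s := univ.image fun y : Fin n → Fin 2 => twoDigitValue b d₁ d₂ y ^ k),
    Finset.sum_image fun y _ z _ h => hinj h, Fintype.expect_eq_sum_div_card, Finset.sum_div]
  · refine Finset.sum_congr rfl fun y _ => ?_
    have h : mu b k d₁ d₂ n (twoDigitValue b d₁ d₂ y ^ k) = ((2 : ℝ) ^ n)⁻¹ := by
      rw [mu, if_pos (isDigitPower_iff.2 ⟨y, rfl⟩)]
    rw [h, expPhase, div_eq_inv_mul]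
    congr 1
    · simp
    · congr 1
      push_cast
      ring
  · intro m hm
    have h : ¬ IsDigitPower b k d₁ d₂ n m := by
      rw [isDigitPower_iff]
      rintro ⟨y, hy⟩
      exact hm (Finset.mem_image.2 ⟨y, Finset.mem_univ _, hy⟩)
    simp [mu, h]

/-- A string of `q * k` bits, cut into `k` strings of `q` bits by the position modulo `k`. -/
def bitBlocks (q k : ℕ) : (Fin k → Fin q → Fin 2) ≃ (Fin (q * k) → Fin 2) :=
  (Equiv.curry (Fin k) (Fin q) (Fin 2)).symm.trans
    (((Equiv.prodComm (Fin k) (Fin q)).trans finProdFinEquiv).arrowCongr (Equiv.refl _))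

lemma bitValue_bitBlocks (b q k : ℕ) (z : Fin k → Fin q → Fin 2) :
    bitValue b (bitBlocks q k z) = ∑ r : Fin k, (b : ℤ) ^ (r : ℕ) * bitValue (b ^ k) (z r) := by
  rw [bitValue, digitValue,
    ← ((Equiv.prodComm (Fin k) (Fin q)).trans finProdFinEquiv).sum_comp, Fintype.sum_prod_type]
  refine Finset.sum_congr rfl fun r _ => ?_
  rw [bitValue, digitValue, Finset.mul_sum]
  refine Finset.sum_congr rfl fun i _ => ?_
  have h : bitBlocks q k z (((Equiv.prodComm (Fin k) (Fin q)).trans finProdFinEquiv) (r, i)) =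
      z r i := by
    simp [bitBlocks, Equiv.arrowCongr]
  rw [h]
  have h2 : ((((Equiv.prodComm (Fin k) (Fin q)).trans finProdFinEquiv) (r, i) : Fin (q * k)) : ℕ) =
      r + k * i := rfl
  rw [h2, pow_add, pow_mul]
  push_cast
  ring

open Polynomial in
-- Differencing for P = θ(X + c)^(K+1), with c the value of the string of all d₁; block 0 remains as
-- the linear variable.
lemma norm_muHat_pow_le {b d₁ d₂ K : ℕ} (hd₁ : d₁ < b) (hd₂ : d₂ < b) (hne : d₁ ≠ d₂) (q : ℕ)
    (θ : ℝ) : ‖muHat b (K + 1) d₁ d₂ (q * (K + 1)) θ‖ ^ 2 ^ K ≤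
      𝔼 x' : Fin K → Fin q → Fin 2, 𝔼 x : Fin K → Fin q → Fin 2,
        ‖𝔼 y : Fin q → Fin 2, expPhase ((K + 1).factorial * θ *
          (∏ j : Fin K, (((d₂ : ℝ) - d₁) * (b : ℝ) ^ ((j : ℕ) + 1) *
              (bitValue (b ^ (K + 1)) (x j) : ℝ) -
            ((d₂ : ℝ) - d₁) * (b : ℝ) ^ ((j : ℕ) + 1) *
              (bitValue (b ^ (K + 1)) (x' j) : ℝ))) *
          (((d₂ : ℝ) - d₁) * (bitValue (b ^ (K + 1)) y : ℝ)))‖ := by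
  set c : ℝ := (digitValue b (fun _ : Fin (q * (K + 1)) => d₁) : ℝ) with hc
  have hmonic : ((X + C c : ℝ[X]) ^ (K + 1)).Monic := (monic_X_add_C c).pow _
  have hdeg : ((X + C c : ℝ[X]) ^ (K + 1)).natDegree = K + 1 := by
    rw [natDegree_pow, natDegree_X_add_C, mul_one]
  have hcoeff : (C θ * (X + C c) ^ (K + 1) : ℝ[X]).coeff (K + 1) = θ := by
    rw [coeff_C_mul]
    have h := hmonic.coeff_natDegree
    rw [hdeg] at h
    rw [h, mul_one]
  have h := norm_expect_expPhase_pow_le K (C θ * (X + C c) ^ (K + 1))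
    ((natDegree_C_mul_le _ _).trans hdeg.le)
    (fun (j : Fin K) (y : Fin q → Fin 2) => ((d₂ : ℝ) - d₁) * (b : ℝ) ^ ((j : ℕ) + 1) *
      (bitValue (b ^ (K + 1)) y : ℝ))
    (fun y : Fin q → Fin 2 => ((d₂ : ℝ) - d₁) * (bitValue (b ^ (K + 1)) y : ℝ))
  rw [hcoeff] at h
  refine le_trans (le_of_eq ?_) h
  congr 2
  rw [muHat_eq (by omega) hd₁ hd₂ hne, ← Fintype.expect_equiv (bitBlocks q (K + 1)) _ _
    (fun _ => rfl), expect_fin_succ, Finset.expect_comm]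
  refine Finset.expect_congr rfl fun x _ => Finset.expect_congr rfl fun y _ => ?_
  congr 1
  rw [twoDigitValue_eq, bitValue_bitBlocks, Fin.sum_univ_succ]
  simp only [eval_mul, eval_C, eval_pow, eval_add, eval_X, Fin.cons_zero, Fin.cons_succ,
    Fin.val_zero, pow_zero, one_mul, Fin.val_succ]
  congr 2
  push_cast
  rw [← hc, mul_add, Finset.mul_sum]
  simp only [mul_assoc]
  ring

/-- The integer that multiplies the product of differences after repeated differencing. -/
def differencingFactor (b d₁ d₂ K : ℕ) : ℤ :=
  (K + 1).factorial * ((d₂ : ℤ) - d₁) * ∏ j : Fin K, (((d₂ : ℤ) - d₁) * (b : ℤ) ^ ((j : ℕ) + 1))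

lemma differencingFactor_ne_zero {b d₁ d₂ : ℕ} (hb : 3 ≤ b) (hne : d₁ ≠ d₂) (K : ℕ) :
    differencingFactor b d₁ d₂ K ≠ 0 := by
  have hD : (d₂ : ℤ) - d₁ ≠ 0 := sub_ne_zero.2 (by exact_mod_cast hne.symm)
  have hb0 : (b : ℤ) ≠ 0 := by omega
  refine mul_ne_zero (mul_ne_zero (by exact_mod_cast Nat.factorial_ne_zero _) hD) ?_
  exact Finset.prod_ne_zero_iff.2 fun j _ => mul_ne_zero hD (pow_ne_zero _ hb0)

lemma abs_differencingFactor_le {b d₁ d₂ : ℕ} (hb : 3 ≤ b) (hd₁ : d₁ < b) (hd₂ : d₂ < b) (K : ℕ) :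
    |differencingFactor b d₁ d₂ K| ≤ (b : ℤ) ^ ((K + 1) ^ 2 + 1 + (K + 1) * K) := by
  have hD : |(d₂ : ℤ) - d₁| ≤ b := by rw [abs_le]; constructor <;> omega
  have hb1 : (1 : ℤ) ≤ b := by omega
  have hfac : ((K + 1).factorial : ℤ) ≤ (b : ℤ) ^ ((K + 1) ^ 2) := by
    have h1 : (K + 1).factorial ≤ (K + 1) ^ (K + 1) := Nat.factorial_le_pow _
    have h2 : K + 1 ≤ b ^ (K + 1) := (Nat.lt_pow_self (by omega)).le
    have h3 : (K + 1) ^ (K + 1) ≤ (b ^ (K + 1)) ^ (K + 1) := Nat.pow_le_pow_left h2 _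
    rw [← pow_mul, ← sq] at h3
    exact_mod_cast h1.trans h3
  have hprod : |∏ j : Fin K, (((d₂ : ℤ) - d₁) * (b : ℤ) ^ ((j : ℕ) + 1))| ≤
      (b : ℤ) ^ ((K + 1) * K) := by
    rw [Finset.abs_prod, pow_mul]
    refine (Finset.prod_le_prod (fun j _ => abs_nonneg _) fun j _ => ?_).trans_eq
      (show ∏ _j : Fin K, (b : ℤ) ^ (K + 1) = _ by simp)
    rw [abs_mul, abs_of_nonneg (by positivity : (0 : ℤ) ≤ (b : ℤ) ^ ((j : ℕ) + 1)), pow_succ' _ K]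
    exact mul_le_mul hD (pow_le_pow_right₀ hb1 (by omega)) (by positivity) (by positivity)
  rw [differencingFactor, abs_mul, abs_mul, Nat.abs_cast, pow_add, pow_add, pow_one]
  gcongr

/-- Some x' has average at least 2η over x. Inner averages are at most 1, so those that are at least
η occur with density at least η; there the cosine product bounds the weight. -/
lemma exists_popular_tuples {b d₁ d₂ K q : ℕ} (hb : 3 ≤ b) (hd₁ : d₁ < b) (hd₂ : d₂ < b)
    (hne : d₁ ≠ d₂) {δ θ : ℝ} (hδ : 0 < δ)
    (hμ : δ ≤ ‖muHat b (K + 1) d₁ d₂ (q * (K + 1)) θ‖) :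
    ∃ (x' : Fin K → Fin q → Fin 2) (T : Finset (Fin K → Fin q → Fin 2)),
      δ ^ 2 ^ K / 2 * (2 ^ q) ^ K ≤ #T ∧
      ∀ x ∈ T, wTilde b (q * (K + 1)) (θ * (differencingFactor b d₁ d₂ K *
        ∏ j, (bitValue (b ^ (K + 1)) (x j) - bitValue (b ^ (K + 1)) (x' j)) : ℤ)) ≤
          (b : ℝ) ^ (2 * (K + 1)) * Real.log (1 / (δ ^ 2 ^ K / 2)) := by
  set η := δ ^ 2 ^ K / 2 with hη
  have hη0 : 0 < η := by positivity
  set β : (Fin K → Fin q → Fin 2) → (Fin K → Fin q → Fin 2) → ℝ := fun x' x =>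
    θ * (differencingFactor b d₁ d₂ K *
      ∏ j, (bitValue (b ^ (K + 1)) (x j) - bitValue (b ^ (K + 1)) (x' j)) : ℤ) with hβ
  set g : (Fin K → Fin q → Fin 2) → (Fin K → Fin q → Fin 2) → ℝ := fun x' x =>
    ‖𝔼 y : Fin q → Fin 2, expPhase (∑ i, ((y i : ℕ) : ℝ) *
      (β x' x * ((b ^ (K + 1) : ℕ) : ℝ) ^ (i : ℕ)))‖ with hg
  have hmain : 2 * η ≤ 𝔼 x', 𝔼 x, g x' x := by
    rw [hη, mul_div_cancel₀ _ (two_ne_zero' ℝ)]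
    refine (pow_le_pow_left₀ hδ.le hμ _).trans
      ((norm_muHat_pow_le hd₁ hd₂ hne q θ).trans_eq ?_)
    refine Finset.expect_congr rfl fun x' _ => Finset.expect_congr rfl fun x _ => ?_
    rw [hg]
    congr 1
    refine Finset.expect_congr rfl fun y _ => ?_
    congr 1
    have e1 : ∑ i, ((y i : ℕ) : ℝ) * (β x' x * ((b ^ (K + 1) : ℕ) : ℝ) ^ (i : ℕ)) =
        β x' x * (bitValue (b ^ (K + 1)) y : ℝ) := by
      simp only [bitValue, digitValue, Int.cast_sum, Finset.mul_sum]
      refine Finset.sum_congr rfl fun i _ => ?_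
      push_cast
      ring
    rw [e1, hβ]
    simp only [differencingFactor, ← mul_sub, Finset.prod_mul_distrib]
    push_cast
    ring
  obtain ⟨x', -, hx'⟩ := Finset.exists_le_of_le_expect (Finset.univ_nonempty) hmain
  refine ⟨x', univ.filter fun x => η ≤ g x' x, ?_, ?_⟩
  · have hg1 (x) : g x' x ≤ 1 := by
      refine (norm_expect_le _).trans ?_
      simp [norm_expPhase]
    have hcardH : (Fintype.card (Fin K → Fin q → Fin 2) : ℝ) = (2 ^ q) ^ K := by simp
    rw [Fintype.expect_eq_sum_div_card, hcardH, le_div_iff₀ (by positivity),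
      ← Finset.sum_filter_add_sum_filter_not univ (fun x => η ≤ g x' x)] at hx'
    have h1 : ∑ x with η ≤ g x' x, g x' x ≤ #(univ.filter fun x => η ≤ g x' x) := by
      refine (Finset.sum_le_card_nsmul _ _ 1 fun x _ => hg1 x).trans_eq (by simp)
    have h2 : ∑ x with ¬ η ≤ g x' x, g x' x ≤ (2 ^ q) ^ K * η := by
      refine (Finset.sum_le_card_nsmul _ _ η fun x hx =>
        (not_le.1 (Finset.mem_filter.1 hx).2).le).trans ?_
      rw [nsmul_eq_mul, ← hcardH]
      gcongr
      exact Finset.card_le_univ _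
    linarith
  · intro x hx
    have h1 := sum_distNearestInt_sq_le _ hη0 (Finset.mem_filter.1 hx).2
    refine (wTilde_mul_le b q (K + 1) hb _).trans ?_
    refine mul_le_mul_of_nonneg_left ?_ (by positivity)
    rw [Finset.sum_range]
    have h2 : 0 ≤ ∑ i : Fin q,
        distNearestInt (β x' x * ((b ^ (K + 1) : ℕ) : ℝ) ^ (i : ℕ)) ^ 2 :=
      Finset.sum_nonneg fun _ _ => sq_nonneg _
    linarith

end RestrictedDigits

/-! ### Numerical constants and conclusion -/

namespace RestrictedDigits

open Finset

/-- The factor 2^(K+1) comes from the Cauchy–Schwarz power of δ, the other from `exists_expansion`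
in base b^(K+2). -/
lemma sixteen_mul_pow_le {b : ℕ} (hb : 3 ≤ b) (K : ℕ) :
    2 ^ (K + 1) * (16 * b ^ (K + 2)) ^ (K + 1) ≤ b ^ ((K + 6) * (K + 1)) := by
  have h16 : 16 ≤ b ^ 3 := le_trans (by norm_num) (Nat.pow_le_pow_left hb 3)
  calc 2 ^ (K + 1) * (16 * b ^ (K + 2)) ^ (K + 1)
      ≤ b ^ (K + 1) * (b ^ 3 * b ^ (K + 2)) ^ (K + 1) := by gcongr; omega
    _ = b ^ ((K + 6) * (K + 1)) := by
      rw [← pow_add, ← pow_mul, ← pow_add]; congr 1; ring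

lemma log_one_div_pow_div_two_le {δ : ℝ} (hδ₀ : 0 < δ) (j : ℕ) :
    Real.log (1 / (δ ^ 2 ^ j / 2)) ≤ 2 ^ j * Real.log (2 / δ) := by
  have h1 : 1 / (δ ^ 2 ^ j / 2) ≤ (2 / δ) ^ 2 ^ j := by
    rw [div_pow, one_div_div]
    gcongr
    exact le_self_pow₀ (by norm_num) (by positivity)
  refine (Real.log_le_log (by positivity) h1).trans_eq ?_
  rw [Real.log_pow]
  push_cast
  rfl

lemma pow_div_two_ge {δ : ℝ} (hδ₀ : 0 < δ) (j : ℕ) :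
    (δ / 2) ^ 2 ^ (j + 1) ≤ δ ^ 2 ^ (j + 1) / 2 / 2 := by
  rw [div_pow, div_div]
  gcongr
  calc (2 : ℝ) * 2 = 2 ^ 2 := by norm_num
    _ ≤ 2 ^ 2 ^ (j + 1) := by
      refine pow_le_pow_right₀ (by norm_num) ?_
      exact le_self_pow₀ (by norm_num) (by omega)

lemma norm_muHat_expansion {b d₁ d₂ K q : ℕ} (hb : 3 ≤ b) (hd₁ : d₁ < b) (hd₂ : d₂ < b)
    (hne : d₁ ≠ d₂) {δ θ : ℝ} (hδ₀ : 0 < δ) (hδ₁ : δ ≤ 1)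
    (hμ : δ ≤ ‖muHat b (K + 2) d₁ d₂ (q * (K + 2)) θ‖)
    (hN : (2 / δ) ^ b ^ ((K + 6) * (K + 1)) ≤ ((b ^ (q * (K + 2)) : ℕ) : ℝ)) :
    ∃ V : Finset ℤ, (δ / 2) ^ b ^ ((K + 6) * (K + 1)) *
        ((b ^ (q * (K + 2)) : ℕ) : ℝ) ^ (K + 1) ≤ #V ∧
      ∀ m ∈ V, |m| ≤ (b : ℤ) ^ ((K + 2) ^ 2 + 1 + (K + 2) * (K + 1)) *
          (2 ^ K * ((b ^ (q * (K + 2)) : ℕ) : ℤ) ^ (K + 1)) ∧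
        √(wTilde b (q * (K + 2)) (θ * m)) ≤ (2 * ((b ^ (K + 2) : ℕ) : ℝ)) ^ K *
          (((b ^ (K + 2) : ℕ) : ℝ) *
            √((b : ℝ) ^ (2 * (K + 2)) * (2 ^ (K + 1) * Real.log (2 / δ)))) := by
  obtain ⟨x', T, hTcard, hT⟩ := exists_popular_tuples hb hd₁ hd₂ hne hδ₀ hμ
  set κ := differencingFactor b d₁ d₂ (K + 1) with hκ
  have hκ0 : κ ≠ 0 := differencingFactor_ne_zero hb hne _
  set η := δ ^ 2 ^ (K + 1) / 2 with hη
  have hη0 : 0 < η := by positivity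
  have hδp : δ ^ 2 ^ (K + 1) ≤ 1 := pow_le_one₀ hδ₀.le hδ₁
  have hη1 : η ≤ 1 := by linarith
  set e := (16 * b ^ (K + 2)) ^ (K + 1) with he
  have hNq : b ^ (q * (K + 2)) = (b ^ (K + 2)) ^ q := by rw [← pow_mul, mul_comm]
  have hlow : (δ / 2) ^ b ^ ((K + 6) * (K + 1)) ≤ (η / 2) ^ e := by
    calc (δ / 2) ^ b ^ ((K + 6) * (K + 1)) ≤ (δ / 2) ^ (2 ^ (K + 1) * e) :=
          pow_le_pow_of_le_one (by positivity) (by linarith) (sixteen_mul_pow_le hb K)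
      _ = ((δ / 2) ^ 2 ^ (K + 1)) ^ e := by rw [pow_mul]
      _ ≤ (η / 2) ^ e := pow_le_pow_left₀ (by positivity) (pow_div_two_ge hδ₀ K) _
  have hthr : (2 / η) ^ e ≤ (((b ^ (K + 2)) ^ q : ℕ) : ℝ) := by
    rw [← hNq]
    refine le_trans ?_ hN
    rw [← inv_div η 2, ← inv_div δ 2, inv_pow, inv_pow]
    exact inv_anti₀ (by positivity) hlow
  obtain ⟨V, hV1, hV2⟩ := exists_expansion (B := b ^ (K + 2)) (q := q)
    ((show 2 ≤ b by omega).trans (Nat.le_self_pow (by omega) b)) K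
    (fun m => √(wTilde b (q * (K + 2)) (θ * ((κ * m : ℤ) : ℝ))))
    (by simp [wTilde, distNearestInt])
    (fun x y => by
      rw [mul_add κ x y, Int.cast_add, mul_add θ]
      exact sqrt_wTilde_add_le _ _ _ _) x'
    (R := √((b : ℝ) ^ (2 * (K + 2)) * (2 ^ (K + 1) * Real.log (2 / δ)))) (Real.sqrt_nonneg _) T
    (fun x hx => Real.sqrt_le_sqrt ((hT x hx).trans
      (mul_le_mul_of_nonneg_left (log_one_div_pow_div_two_le hδ₀ _) (by positivity))))
    hη0 hη1 hTcard hthr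
  rw [hNq]
  refine ⟨V.image (κ * ·), ?_, ?_⟩
  -- Multiplication by κ ≠ 0 loses no elements.
  · rw [Finset.card_image_of_injective _ (mul_right_injective₀ hκ0)]
    refine le_trans ?_ hV1
    gcongr
  · intro m hm
    obtain ⟨v, hv, rfl⟩ := Finset.mem_image.1 hm
    refine ⟨?_, (hV2 v hv).2⟩
    rw [abs_mul]
    exact mul_le_mul (abs_differencingFactor_le hb hd₁ hd₂ (K + 1)) (hV2 v hv).1 (abs_nonneg _)
      (by positivity)

lemma pow_le_rpow_of_two_mul_le {b k j : ℕ} (hb : 3 ≤ b) (h : 2 * j ≤ 7 * k ^ 2) :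
    (b : ℝ) ^ j ≤ (b : ℝ) ^ (7 * (k : ℝ) ^ 2 / 2) := by
  rw [← Real.rpow_natCast]
  refine Real.rpow_le_rpow_of_exponent_le ?_ ?_
  · exact_mod_cast (show 1 ≤ b by omega)
  · have : (2 * j : ℝ) ≤ 7 * (k : ℝ) ^ 2 := by exact_mod_cast h
    linarith

end RestrictedDigits

theorem mainTheorem7 (b k d₁ d₂ n N : ℕ) (C δ θ : ℝ)
    (hb : 3 ≤ b) (hk : 2 ≤ k)
    (hd₁ : d₁ < b) (hd₂ : d₂ < b) (hne : d₁ ≠ d₂) (hcop : Nat.Coprime d₁ d₂)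
    (hC : C = (b : ℝ) ^ (7 * (k : ℝ) ^ 2 / 2)) (hN : N = b ^ n)
    (hδ₀ : 0 < δ) (hδ₁ : δ ≤ 1) (hkn : k ∣ n)
    (hμ : δ ≤ ‖RestrictedDigits.muHat b k d₁ d₂ n θ‖)
    (hNC : (2 / δ) ^ C ≤ (N : ℝ)) :
    (δ / 2) ^ C * (N : ℝ) ^ (k - 1) ≤
      (({m : ℤ | |(m : ℝ)| ≤ C * (N : ℝ) ^ (k - 1) ∧
        RestrictedDigits.wTilde b n (θ * m) ≤ C * Real.log (2 / δ)}.ncard : ℕ) : ℝ) := by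
  obtain ⟨K, rfl⟩ : ∃ K, k = K + 2 := ⟨k - 2, by omega⟩
  obtain ⟨q, rfl⟩ : ∃ q, n = q * (K + 2) := by
    obtain ⟨q, rfl⟩ := hkn
    exact ⟨q, mul_comm _ _⟩
  rw [show K + 2 - 1 = K + 1 by omega]
  -- The losses in density exponent, size and weight are all bounded by powers of b with exponent at
  -- most 7k²/2.
  have hpow (j : ℕ) (hj : 2 * j ≤ 7 * (K + 2) ^ 2) : (b : ℝ) ^ j ≤ C := by
    rw [hC]
    exact RestrictedDigits.pow_le_rpow_of_two_mul_le hb hj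
  have hb1 : (1 : ℝ) ≤ b := by exact_mod_cast (show 1 ≤ b by omega)
  have hb2 : (2 : ℝ) ≤ b := by exact_mod_cast (show 2 ≤ b by omega)
  have hlog : 0 ≤ Real.log (2 / δ) := by
    refine Real.log_nonneg ?_
    rw [le_div_iff₀ hδ₀]
    linarith
  have hexp : ((b ^ ((K + 6) * (K + 1)) : ℕ) : ℝ) ≤ C := by
    push_cast
    exact hpow _ (by nlinarith)
  obtain ⟨V, hV1, hV2⟩ := RestrictedDigits.norm_muHat_expansion hb hd₁ hd₂ hne hδ₀ hδ₁ hμ (by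
    rw [← hN]
    refine le_trans ?_ hNC
    rw [← Real.rpow_natCast]
    refine Real.rpow_le_rpow_of_exponent_le ?_ hexp
    rw [le_div_iff₀ hδ₀]
    linarith)
  rw [← hN] at hV1 hV2
  have hsub : (V : Set ℤ) ⊆ {m : ℤ | |(m : ℝ)| ≤ C * (N : ℝ) ^ (K + 1) ∧
      RestrictedDigits.wTilde b (q * (K + 2)) (θ * m) ≤ C * Real.log (2 / δ)} := by
    intro m hm
    obtain ⟨h1, h2⟩ := hV2 m hm
    constructor
    · have h3 : |(m : ℝ)| ≤ (b : ℝ) ^ ((K + 2) ^ 2 + 1 + (K + 2) * (K + 1)) *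
          (2 ^ K * (N : ℝ) ^ (K + 1)) := by exact_mod_cast h1
      refine h3.trans ?_
      rw [← mul_assoc]
      refine mul_le_mul_of_nonneg_right ?_ (by positivity)
      calc (b : ℝ) ^ ((K + 2) ^ 2 + 1 + (K + 2) * (K + 1)) * 2 ^ K
          ≤ (b : ℝ) ^ ((K + 2) ^ 2 + 1 + (K + 2) * (K + 1)) * (b : ℝ) ^ K := by gcongr
        _ = (b : ℝ) ^ ((K + 2) ^ 2 + 1 + (K + 2) * (K + 1) + K) := by rw [← pow_add]
        _ ≤ C := hpow _ (by nlinarith)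
    · have h3 := (Real.sqrt_le_left (by positivity)).1 h2
      refine h3.trans ?_
      rw [mul_pow _ _ 2, mul_pow ((b ^ (K + 2) : ℕ) : ℝ) _ 2, Real.sq_sqrt (by positivity)]
      push_cast
      calc ((2 * (b : ℝ) ^ (K + 2)) ^ K) ^ 2 * (((b : ℝ) ^ (K + 2)) ^ 2 *
            ((b : ℝ) ^ (2 * (K + 2)) * (2 ^ (K + 1) * Real.log (2 / δ))))
          ≤ ((b * (b : ℝ) ^ (K + 2)) ^ K) ^ 2 * (((b : ℝ) ^ (K + 2)) ^ 2 *
            ((b : ℝ) ^ (2 * (K + 2)) * ((b : ℝ) ^ (K + 1) * Real.log (2 / δ)))) := by gcongr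
        _ = (b : ℝ) ^ ((K + 3) * K * 2 + (K + 2) * 2 + 2 * (K + 2) + (K + 1)) *
            Real.log (2 / δ) := by ring
        _ ≤ C * Real.log (2 / δ) := mul_le_mul_of_nonneg_right (hpow _ (by nlinarith)) hlog
  -- `Set.ncard` is 0 on infinite sets, so finiteness is needed for monotonicity.
  have hfin : {m : ℤ | |(m : ℝ)| ≤ C * (N : ℝ) ^ (K + 1) ∧
      RestrictedDigits.wTilde b (q * (K + 2)) (θ * m) ≤ C * Real.log (2 / δ)}.Finite := by
    refine (Set.finite_Icc (-⌊C * (N : ℝ) ^ (K + 1)⌋) ⌊C * (N : ℝ) ^ (K + 1)⌋).subset ?_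
    intro m hm
    rw [Set.mem_Icc, ← abs_le, Int.le_floor]
    simpa using hm.1
  calc (δ / 2) ^ C * (N : ℝ) ^ (K + 1)
      ≤ (δ / 2) ^ b ^ ((K + 6) * (K + 1)) * (N : ℝ) ^ (K + 1) := by
        refine mul_le_mul_of_nonneg_right ?_ (by positivity)
        rw [← Real.rpow_natCast]
        exact Real.rpow_le_rpow_of_exponent_ge (by positivity) (by linarith) hexp
    _ ≤ V.card := hV1
    _ ≤ _ := by
      rw [← Set.ncard_coe_finset]
      exact_mod_cast Set.ncard_le_ncard hsub hfin
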